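/- **Setting.** Let $n,m,R_y,R_x\ge 1$, $\underline q=(q_1,\dots,q_n)$, $\underline p=(p_1,\dots,p_m)$ be positive integers, $Q=\prod_i q_i$, $P=\prod_j p_j$. For a tensor $\mathcal A\in\mathbb R^{q_1\times\cdots\times q_n\times p_1\times\cdots\times p_m}$ let $[\mathcal A]_n\in\mathbb R^{Q\times P}$ be its sequential matricization (first $n$ modes as rows, last $m$ modes as columns). Let $\mathcal S(\underline d,R)$ be the set of Khatri–Rao products $U_k\odot\cdots\odot U_1$ of matrices $U_i\in\mathbb R^{d_i\times R}$ with columns of unit Euclidean norm, and $$\Theta_{\rm LR}=\{\mathcal A:\ [\mathcal A]_n=\Lambda_y G\Lambda_x^\top,\ \Lambda_y\in\mathcal S(\underline q,R_y),\ G\in\mathbb R^{R_y\times R_x},\ \Lambda_x\in\mathcal S(\underline p,R_x)\};$$ for $g>0$ let $\Theta_{\rm LR}^g$ be the subset of those $\mathcal A$ that admit such a representation with $\|G\|_{\rm op}\le g$. Let $(\mathcal X_t,\mathcal Y_t)$, $t=1,\dots,T$, be i.i.d. with $\mathcal Y_t=\langle\mathcal A^*,\mathcal X_t\rangle+\mathcal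 E_t$, i.e. $y_t=[\mathcal A^*]_n x_t+e_t$ for $x_t=\mathrm{vec}(\mathcal X_t)$, $y_t=\mathrm{vec}(\mathcal Y_t)$, $e_t=\mathrm{vec}(\mathcal E_t)$, where $\mathcal A^*\in\Theta^g_{\rm LR}$. Call a random vector $z$ $\tau^2$-sub-Gaussian if $\mathbb E\,e^{\langle u,z\rangle}\le e^{\tau^2\|u\|_2^2/2}$ for all $u$. Let $\sigma,\kappa>0$ and $0<c_x\le C_x$, and assume that $x_t$ has mean zero, is $\sigma^2$-sub-Gaussian, and has a covariance matrix $\Sigma_x$ with all eigenvalues in $[c_x,C_x]$; and that, conditionally on $x_t$, $e_t$ has mean zero and is $\kappa^2$-sub-Gaussian. Put $$d_{\rm LR}=R_yR_x+R_y\sum_{i=1}^n q_i+R_x\sum_{j=1}^m p_j,\qquad d_c=\log\big((m\vee n)(R_y\wedge R_x)R_y^{1/2}R_x^{1/2}\big),$$ $$d'_{\rm LR}=R_yR_x+R_y+R_x\sum_{j=1}^m p_j,\qquad d'_c=\log\big(m(R_y\wedge R_x)R_y^{1/2}R_x^{1/2}\big).$$ **Theorem.** For every $g>0$ there are positive constants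 $C_0,C_1,c_1,c_2,c_3$, depending only on $g$, such that the following holds in every such setting. Suppose that either 1. $T\ge C_0\max(1,\sigma^4/c_x^2)\,\big(d_cd_{\rm LR}+\sum_{i=1}^n\log q_i\big)$, or 2. the standardized covariates $\Sigma_x^{-1/2}x_t$ are $\sigma^2$-sub-Gaussian as well, and $T\ge C_0\max(1,\sigma^4)\,\big(d_cd_{\rm LR}+\sum_{i=1}^n\log q_i\big)$. Then, with probability at least $1-\exp\{-c_1d_cd_{\rm LR}\}-\exp\{-c_2d'_cd'_{\rm LR}-c_3\sum_{i=1}^n\log q_i\}$, every minimizer $\widehat{\mathcal A}_{\rm LR}$ of the least-squares loss $\frac1T\sum_{t=1}^T\|y_t-[\mathcal A]_nx_t\|_2^2$ over $\Theta_{\rm LR}$, and every minimizer over $\Theta_{\rm LR}^g$, satisfies $$\|\widehat{\mathcal A}_{\rm LR}-\mathcal A^*\|_{\rm F}\le C_1\,\frac{\kappa\sigma}{c_x}\sqrt{\frac{d_cd_{\rm LR}}{T}}.$$ -/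

import Mathlib

open MeasureTheory ProbabilityTheory
open scoped NNReal

noncomputable section

/-- Multi-indices of a tensor with mode sizes `d 0, …, d (k-1)`. A vectorized tensor is a vector
indexed by them. -/
abbrev MultiIdx {k : ℕ} (d : Fin k → ℕ) : Type := (i : Fin k) → Fin (d i)

/-- Real tensors of shape `d 0 × ⋯ × d (k-1)`, normed by the Frobenius norm. -/
abbrev RTensor {k : ℕ} (d : Fin k → ℕ) : Type := EuclideanSpace ℝ (MultiIdx d)

/-- Coefficient tensors of shape `q 0 × ⋯ × q (n-1) × p 0 × ⋯ × p (m-1)`, normed by the Frobenius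
norm; the first `n` modes and the last `m` modes are grouped in the index. -/
abbrev CoefTensor {n m : ℕ} (q : Fin n → ℕ) (p : Fin m → ℕ) : Type :=
  EuclideanSpace ℝ (MultiIdx q × MultiIdx p)

/-- The sequential matricization at mode `n`: the first `n` modes index the rows, the last `m`
modes index the columns. -/
def seqMat {n m : ℕ} {q : Fin n → ℕ} {p : Fin m → ℕ} (A : CoefTensor q p) :
    Matrix (MultiIdx q) (MultiIdx p) ℝ :=
  Matrix.of fun a b => A (a, b)

/-- The generalized inner product `⟨A, X⟩`, with entries `∑ b, A (a, b) * X b`. -/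
def contract {n m : ℕ} {q : Fin n → ℕ} {p : Fin m → ℕ} (A : CoefTensor q p) (X : RTensor p) :
    RTensor q :=
  WithLp.toLp 2 fun a => ∑ b, A (a, b) * X b

/-- The (columnwise Kronecker) Khatri-Rao product of the matrices `U i`; its `r`-th column is the
vectorized outer product of the `r`-th columns of the `U i`. -/
def khatriRao {k : ℕ} {d : Fin k → ℕ} {R : ℕ} (U : (i : Fin k) → Matrix (Fin (d i)) (Fin R) ℝ) :
    Matrix (MultiIdx d) (Fin R) ℝ :=
  Matrix.of fun a r => ∏ i, U i (a i) r

/-- The set `S(d, R)` of CP-structured loading matrices: Khatri-Rao products of matrices with `R`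
columns of unit Euclidean norm. -/
def loadingSet {k : ℕ} (d : Fin k → ℕ) (R : ℕ) : Set (Matrix (MultiIdx d) (Fin R) ℝ) :=
  {L | ∃ U : (i : Fin k) → Matrix (Fin (d i)) (Fin R) ℝ,
    (∀ i r, ‖(WithLp.toLp 2 (fun a => U i a r) : EuclideanSpace ℝ (Fin (d i)))‖ = 1) ∧
    L = khatriRao U}

/-- The operator (spectral) norm of a rectangular matrix. -/
def opNorm {a b : ℕ} (G : Matrix (Fin a) (Fin b) ℝ) : ℝ :=
  ‖LinearMap.toContinuousLinearMap (Matrix.toEuclideanLin G)‖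

/-- The parameter space `Θ_LR(q, p, Ry, Rx)`. -/
def thetaLR {n m : ℕ} (q : Fin n → ℕ) (p : Fin m → ℕ) (Ry Rx : ℕ) : Set (CoefTensor q p) :=
  {A | ∃ Ly ∈ loadingSet q Ry, ∃ G : Matrix (Fin Ry) (Fin Rx) ℝ, ∃ Lx ∈ loadingSet p Rx,
    seqMat A = Ly * G * Lx.transpose}

/-- The elements of `Θ_LR(q, p, Ry, Rx)` whose matrix `G` has operator norm at most `g`. -/
def thetaLRBdd {n m : ℕ} (q : Fin n → ℕ) (p : Fin m → ℕ) (Ry Rx : ℕ) (g : ℝ) :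
    Set (CoefTensor q p) :=
  {A | ∃ Ly ∈ loadingSet q Ry, ∃ G : Matrix (Fin Ry) (Fin Rx) ℝ, ∃ Lx ∈ loadingSet p Rx,
    opNorm G ≤ g ∧ seqMat A = Ly * G * Lx.transpose}

/-- The least-squares loss of `A` on the sample `(x t, y t)`, `t = 1, …, T`. -/
def olsLoss {n m T : ℕ} {q : Fin n → ℕ} {p : Fin m → ℕ} (x : Fin T → RTensor p)
    (y : Fin T → RTensor q) (A : CoefTensor q p) : ℝ :=
  (∑ t, ‖y t - contract A (x t)‖ ^ 2) / T

/-- `A` is an ordinary least-squares estimate over the constraint set `K`. -/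
def IsOLS {n m T : ℕ} {q : Fin n → ℕ} {p : Fin m → ℕ} (K : Set (CoefTensor q p))
    (x : Fin T → RTensor p) (y : Fin T → RTensor q) (A : CoefTensor q p) : Prop :=
  A ∈ K ∧ ∀ B ∈ K, olsLoss x y A ≤ olsLoss x y B

/-- The covariance matrix of a random vector. -/
def covMat {ι Ω : Type*} [MeasurableSpace Ω] (x : Ω → EuclideanSpace ℝ ι) (μ : Measure Ω) :
    Matrix ι ι ℝ :=
  Matrix.of fun i j => cov[fun ω => x ω i, fun ω => x ω j; μ]

/-- The random vector `x` is `σ²`-sub-Gaussian: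
`E exp(s ⟨u, x⟩) ≤ exp(σ² ‖u‖² s² / 2)` for all vectors `u` and reals `s`. -/
def IsSubGaussianVec {ι Ω : Type*} [Fintype ι] [MeasurableSpace Ω]
    (x : Ω → EuclideanSpace ℝ ι) (σ : ℝ) (μ : Measure Ω) : Prop :=
  ∀ u : EuclideanSpace ℝ ι,
    HasSubgaussianMGF (fun ω => inner ℝ u (x ω)) (Real.toNNReal (σ ^ 2 * ‖u‖ ^ 2)) μ

/-- The standardized vector `Σ^(-1/2) x` is `σ²`-sub-Gaussian, where `Σ` is the (invertible)
covariance matrix of `x`. It is written in the direction `u = Σ^(-1/2) v`, for which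
`⟨v, Σ^(-1/2) x⟩ = ⟨u, x⟩` and `‖v‖² = uᵀ Σ u`. -/
def IsStandardizedSubGaussianVec {ι Ω : Type*} [Fintype ι] [MeasurableSpace Ω]
    (x : Ω → EuclideanSpace ℝ ι) (σ : ℝ) (μ : Measure Ω) : Prop :=
  ∀ u : EuclideanSpace ℝ ι,
    HasSubgaussianMGF (fun ω => inner ℝ u (x ω))
      (Real.toNNReal (σ ^ 2 * (u.ofLp ⬝ᵥ (covMat x μ).mulVec u.ofLp))) μ

/-- Covariate assumption: mean zero, `σ²`-sub-Gaussian, all eigenvalues of the covariance matrix in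
`[cx, Cx]` with `0 < cx ≤ Cx`. -/
structure CovariateAssumption {ι Ω : Type*} [Fintype ι] [DecidableEq ι] [MeasurableSpace Ω]
    (x : Ω → EuclideanSpace ℝ ι) (σ cx Cx : ℝ) (μ : Measure Ω) : Prop where
  mean_zero : ∀ i, ∫ ω, x ω i ∂μ = 0
  subGaussian : IsSubGaussianVec x σ μ
  cx_pos : 0 < cx
  cx_le : cx ≤ Cx
  eigenvalues : ∀ l ∈ spectrum ℝ (covMat x μ), cx ≤ l ∧ l ≤ Cx

/-- Error assumption: under the conditional distribution of `e` given `x`, the error has mean zero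
and is `κ²`-sub-Gaussian. -/
structure ErrorAssumption {ι ι' Ω : Type*} [Fintype ι] [Fintype ι'] [MeasurableSpace Ω]
    (x : Ω → EuclideanSpace ℝ ι) (e : Ω → EuclideanSpace ℝ ι') (κ : ℝ) (μ : Measure Ω)
    [IsFiniteMeasure μ] : Prop where
  mean_zero : ∀ᵐ v ∂(μ.map x), ∀ i, ∫ w, w i ∂(condDistrib e x μ v) = 0
  subGaussian : ∀ u : EuclideanSpace ℝ ι',
    Kernel.HasSubgaussianMGF (fun w => inner ℝ u w) (Real.toNNReal (κ ^ 2 * ‖u‖ ^ 2))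
      (condDistrib e x μ) (μ.map x)

/-- The model complexity `d_LR = Ry Rx + Ry ∑ q_i + Rx ∑ p_j`. -/
def dLR {n m : ℕ} (q : Fin n → ℕ) (p : Fin m → ℕ) (Ry Rx : ℕ) : ℝ :=
  Ry * Rx + Ry * ∑ i, (q i : ℝ) + Rx * ∑ j, (p j : ℝ)

/-- `d'_LR = Ry Rx + Ry + Rx ∑ p_j`. -/
def dLR' {m : ℕ} (p : Fin m → ℕ) (Ry Rx : ℕ) : ℝ :=
  Ry * Rx + Ry + Rx * ∑ j, (p j : ℝ)

/-- `d_c = log ((m ∨ n) (Ry ∧ Rx) Ry^(1/2) Rx^(1/2))`. -/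
def dc (n m Ry Rx : ℕ) : ℝ :=
  Real.log (max (m : ℝ) n * min (Ry : ℝ) Rx * √(Ry : ℝ) * √(Rx : ℝ))

/-- `d'_c = log (m (Ry ∧ Rx) Ry^(1/2) Rx^(1/2))`. -/
def dc' (m Ry Rx : ℕ) : ℝ :=
  Real.log ((m : ℝ) * min (Ry : ℝ) Rx * √(Ry : ℝ) * √(Rx : ℝ))

end

/-!
The least-squares deviation `D = Â - A*` satisfies the basic inequality
`∑ ‖⟨D, x t⟩‖² ≤ 2 ∑ ⟨⟨D, x t⟩, e t⟩`. The error bound follows once, uniformly over all deviations,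
the left side is at least `T / 2` times the population form `v(D) = E ‖⟨D, x⟩‖² ≥ cx ‖D‖²`, and the
noise term is at most a multiple of `κ √(T * dc * dLR) * √(v(D))`.

The representations in `Θ_LR` can be arbitrarily ill conditioned, so covering the parameters
`(Λ_y, G, Λ_x)` does not cover the normalized deviations. The uniformity comes instead from the fact
that the entries of `D` are polynomials of degree `n + m + 1` in `dLR` free parameters. For
polynomials `h` of degree `d` in `k` variables and a weight `ρ`, the powers `(h / ρ) ^ s` with `s`
of order `d * k` span a space of dimension at most `(27 d²) ^ k`. Near-optimal Fekete points of this
space (`exists_fekete_points`) control the supremum of `|h / ρ| ^ s` by twice the sum over the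
points, and after an `s`-th root the supremum of `|h / ρ|` by three times its maximum over the
points (`exists_norming_finset`). The points do not depend on the sample, and the logarithm of their number
is `O(dc * dLR)` whatever the conditioning of the representation and the ambient dimension.

It remains to prove tail bounds at a fixed `D` and to take union bounds over two such sets of
points. The empirical form concentrates since `‖⟨D, x⟩‖² / v(D)` is a convex combination of squares
of normalized sub-Gaussian variables (`integral_exp_sum_sq_le`). The noise term has a conditionally
sub-Gaussian tail (`ErrorAssumption.integral_exp_inner_le`) with variance proxy
`κ² ∑ ‖⟨D, x t⟩‖²`, which the first bound replaces by `3/2 * κ² * T * v(D)`. Both conditions on the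
sample size are used in the form that the projections of `x` have sub-Gaussian parameter at most `K`
times their variance and `T` is at least a multiple of `K² * (dc * dLR + ∑ log (q i))`. The
resulting constants do not depend on `g`.
-/

/-! ### Polynomial functions of bounded degree -/

/-- The polynomial functions of total degree at most `d` in the variables `ι`, as the span of the
monomials that are products of `d` factors, each a coordinate or (for `none`) the constant `1`. -/
def polyDeg (ι : Type*) (d : ℕ) : Submodule ℝ ((ι → ℝ) → ℝ) :=
  Submodule.span ℝ (Set.range fun s : Sym (Option ι) d =>
    fun x : ι → ℝ => ((s : Multiset (Option ι)).map fun o => o.elim 1 x).prod)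

lemma polyDeg_mul {ι : Type*} {a b : ℕ} {f g : (ι → ℝ) → ℝ} (hf : f ∈ polyDeg ι a)
    (hg : g ∈ polyDeg ι b) : (fun x => f x * g x) ∈ polyDeg ι (a + b) := by
  have h : f * g ∈ polyDeg ι a * polyDeg ι b := Submodule.mul_mem_mul hf hg
  unfold polyDeg at h
  rw [Submodule.span_mul_span] at h
  refine Submodule.span_mono ?_ h
  rintro _ ⟨_, ⟨s, rfl⟩, _, ⟨t, rfl⟩, rfl⟩
  refine ⟨s.append t, ?_⟩
  ext x
  simp [Sym.coe_append]

lemma polyDeg_const {ι : Type*} (d : ℕ) (c : ℝ) : (fun _ => c) ∈ polyDeg ι d := by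
  have h : (fun _ : ι → ℝ => (1 : ℝ)) ∈ polyDeg ι d :=
    Submodule.subset_span ⟨Sym.replicate d none, by ext x; simp [Sym.coe_replicate]⟩
  simpa [Pi.smul_def] using (polyDeg ι d).smul_mem c h

lemma polyDeg_coord {ι : Type*} (i : ι) : (fun x => x i) ∈ polyDeg ι 1 :=
  Submodule.subset_span ⟨Sym.replicate 1 (some i), by ext x; simp [Sym.coe_replicate]⟩

lemma polyDeg_sum {ι α : Type*} {d : ℕ} (s : Finset α) {f : α → (ι → ℝ) → ℝ}
    (hf : ∀ a ∈ s, f a ∈ polyDeg ι d) : (fun x => ∑ a ∈ s, f a x) ∈ polyDeg ι d := by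
  simpa [Finset.sum_fn] using (polyDeg ι d).sum_mem hf

lemma polyDeg_prod {ι α : Type*} (s : Finset α) {f : α → (ι → ℝ) → ℝ}
    (hf : ∀ a ∈ s, f a ∈ polyDeg ι 1) : (fun x => ∏ a ∈ s, f a x) ∈ polyDeg ι s.card := by
  classical
  induction s using Finset.induction_on with
  | empty => simpa using polyDeg_const 0 1
  | insert a s ha ih =>
    simp only [Finset.prod_insert ha, Finset.card_insert_of_notMem ha]
    rw [add_comm]
    exact polyDeg_mul (hf a (by simp)) (ih fun b hb => hf b (by simp [hb]))

lemma polyDeg_pow {ι : Type*} {d : ℕ} {f : (ι → ℝ) → ℝ} (hf : f ∈ polyDeg ι d) (k : ℕ) :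
    (fun x => f x ^ k) ∈ polyDeg ι (d * k) := by
  induction k with
  | zero => simpa using polyDeg_const 0 1
  | succ k ih => simpa [pow_succ, Nat.mul_succ] using polyDeg_mul ih hf

instance {ι : Type*} [Finite ι] (d : ℕ) : FiniteDimensional ℝ (polyDeg ι d) := by
  have := Fintype.ofFinite ι
  classical
  exact FiniteDimensional.span_of_finite ℝ (Set.finite_range _)

lemma finrank_polyDeg_le (ι : Type*) [Fintype ι] (d : ℕ) :
    Module.finrank ℝ (polyDeg ι d) ≤ (Fintype.card ι + d).choose d := by
  classical
  refine (finrank_range_le_card _).trans ?_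
  rw [Sym.card_sym_eq_multichoose, Fintype.card_option, Nat.multichoose_eq]
  rw [Nat.add_right_comm, Nat.add_sub_cancel]

/-! ### Norming sets -/

/-- Near-optimal Fekete points. The points `u j` nearly maximize the determinant of the evaluation
matrix of a basis of `F`; by Cramer's rule every evaluation functional on `F` is then a combination
of the evaluations at the `u j` with coefficients at most `2`. -/
lemma exists_fekete_points {Θ : Type*} (F : Submodule ℝ (Θ → ℝ)) [FiniteDimensional ℝ F]
    (hb : ∀ g ∈ F, ∃ C, ∀ θ, |g θ| ≤ C) :
    ∃ u : Fin (Module.finrank ℝ F) → Θ, ∀ g ∈ F, ∀ θ, |g θ| ≤ 2 * ∑ j, |g (u j)| := by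
  set r := Module.finrank ℝ F with hr
  let b : Module.Basis (Fin r) ℝ F := Module.finBasis ℝ F
  let Φ : Θ → Fin r → ℝ := fun θ i => (b i : Θ → ℝ) θ
  have hexp : ∀ g (hg : g ∈ F) θ, g θ = ∑ i, b.repr ⟨g, hg⟩ i * Φ θ i := by
    intro g hg θ
    have := congrArg (fun f : F => (f : Θ → ℝ) θ) (b.sum_repr ⟨g, hg⟩)
    rw [AddSubmonoidClass.coe_finsetSum] at this
    simpa [-Module.Basis.sum_repr, Φ, Finset.sum_apply] using this.symm
  have hspan : Submodule.span ℝ (Set.range Φ) = ⊤ := by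
    by_contra hne
    obtain ⟨f, hf0, hf⟩ := Submodule.exists_le_ker_of_lt_top _ (lt_top_iff_ne_top.2 hne)
    refine hf0 ?_
    have hz : ∑ i, f (Pi.single i 1) • b i = 0 := by
      ext θ
      have h1 : f (Φ θ) = 0 := hf (Submodule.subset_span ⟨θ, rfl⟩)
      rw [← Finset.univ_sum_single (Φ θ), map_sum] at h1
      have h2 : ∀ i, f (Pi.single i (Φ θ i)) = f (Pi.single i 1) * Φ θ i := by
        intro i
        rw [mul_comm, ← smul_eq_mul, ← map_smul, ← Pi.single_smul]; simp
      simp only [h2] at h1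
      simpa [Finset.sum_apply, Φ] using h1
    have h3 := Fintype.linearIndependent_iff.1 b.linearIndependent _ hz
    refine LinearMap.pi_ext' fun i => ?_
    ext
    simpa using h3 i
  -- Some evaluation matrix is invertible.
  have hex : ∃ u : Fin r → Θ, (Matrix.of fun j i => Φ (u j) i).det ≠ 0 := by
    obtain ⟨f, hf, hfs, hli⟩ := Submodule.exists_fun_fin_finrank_span_eq ℝ (Set.range Φ)
    have hcard : Module.finrank ℝ (Submodule.span ℝ (Set.range Φ)) = r := by
      rw [hspan]; simp
    choose v hv using hf
    refine ⟨fun j => v (Fin.cast hcard.symm j), ?_⟩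
    have hli' : LinearIndependent ℝ (fun j : Fin r => f (Fin.cast hcard.symm j)) :=
      hli.comp _ (Fin.cast_injective _)
    have : (Matrix.of fun j i => Φ (v (Fin.cast hcard.symm j)) i) =
        Matrix.of fun j : Fin r => f (Fin.cast hcard.symm j) := by
      ext j i; simp [hv]
    rw [this]
    have h4 := (Matrix.linearIndependent_rows_iff_isUnit
      (A := Matrix.of fun j : Fin r => f (Fin.cast hcard.symm j))).1 hli'
    exact ((Matrix.isUnit_iff_isUnit_det _).1 h4).ne_zero
  choose C hC using fun i => hb (b i) (b i).2
  have hbdd : BddAbove (Set.range fun u : Fin r → Θ =>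
      |(Matrix.of fun j i => Φ (u j) i).det|) := by
    refine ⟨∑ σ : Equiv.Perm (Fin r), ∏ i, C i, ?_⟩
    rintro _ ⟨u, rfl⟩
    dsimp only
    rw [Matrix.det_apply]
    refine (Finset.abs_sum_le_sum_abs _ _).trans (Finset.sum_le_sum fun σ _ => ?_)
    rw [Units.smul_def, zsmul_eq_mul, abs_mul, Finset.abs_prod]
    have : |((Equiv.Perm.sign σ : ℤ) : ℝ)| = 1 := by
      rcases Int.units_eq_one_or (Equiv.Perm.sign σ) with h | h <;> simp [h]
    rw [this, one_mul]
    exact Finset.prod_le_prod (fun _ _ => abs_nonneg _) fun i _ => hC i _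
  obtain ⟨u₀, hu₀⟩ := hex
  set s := ⨆ u : Fin r → Θ, |(Matrix.of fun j i => Φ (u j) i).det| with hs
  have hle : ∀ u : Fin r → Θ, |(Matrix.of fun j i => Φ (u j) i).det| ≤ s := fun u =>
    le_ciSup hbdd u
  have hspos : 0 < s := (abs_pos.2 hu₀).trans_le (hle u₀)
  have : Nonempty (Fin r → Θ) := ⟨u₀⟩
  obtain ⟨u, hu⟩ := exists_lt_of_lt_ciSup (half_lt_self hspos)
  refine ⟨u, fun g hg θ => ?_⟩
  set M : Matrix (Fin r) (Fin r) ℝ := Matrix.of fun j i => Φ (u j) i with hM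
  have hdet : 0 < |M.det| := (half_pos hspos).trans hu
  set a : Fin r → ℝ := fun j => M.det⁻¹ * Matrix.cramer M.transpose (Φ θ) j with ha
  have hcomb : Matrix.mulVec M.transpose a = Φ θ := by
    have : a = M.det⁻¹ • Matrix.cramer M.transpose (Φ θ) := by ext; simp [ha]
    rw [this, Matrix.mulVec_smul, Matrix.mulVec_cramer, Matrix.det_transpose, smul_smul,
      inv_mul_cancel₀ (abs_pos.1 hdet), one_smul]
  have habs : ∀ j, |a j| ≤ 2 := by
    intro j
    have h5 : Matrix.cramer M.transpose (Φ θ) j =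
        (Matrix.of fun k i => Φ (Function.update u j θ k) i).det := by
      rw [Matrix.cramer_transpose_apply]
      congr 1
      ext k i
      rcases eq_or_ne k j with rfl | h <;> simp [Matrix.updateRow_apply, *]
    rw [ha, abs_mul, abs_inv, h5, inv_mul_le_iff₀ hdet]
    have := hle (Function.update u j θ)
    linarith
  have hg' : g θ = ∑ j, a j * g (u j) := by
    rw [hexp g hg θ]
    simp_rw [hexp g hg (u _)]
    rw [← hcomb]
    simp only [Matrix.mulVec, dotProduct, Matrix.transpose_apply, hM, Matrix.of_apply,
      Finset.mul_sum]
    rw [Finset.sum_comm]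
    refine Finset.sum_congr rfl fun j _ => Finset.sum_congr rfl fun i _ => by ring
  rw [hg', Finset.mul_sum]
  refine (Finset.abs_sum_le_sum_abs _ _).trans (Finset.sum_le_sum fun j _ => ?_)
  rw [abs_mul]
  exact mul_le_mul_of_nonneg_right (habs j) (abs_nonneg _)

lemma choose_mul_le_pow (k c : ℕ) (hc : 1 ≤ c) :
    ((k + c * k).choose (c * k) : ℝ) ≤ (3 * (1 + c)) ^ k := by
  have hsymm : (k + c * k).choose (c * k) = (k + c * k).choose k := by
    rw [← Nat.choose_symm_add]
  set x : ℝ := (1 + c : ℝ)⁻¹ with hx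
  have hxpos : 0 < x := by positivity
  have h1 : ((k + c * k).choose k : ℝ) * x ^ k ≤ (1 + x) ^ (k + c * k) := by
    rw [add_comm 1 x, add_pow]
    refine le_trans (le_of_eq ?_) (Finset.single_le_sum (f := fun m : ℕ =>
      x ^ m * 1 ^ (k + c * k - m) * ((k + c * k).choose m : ℝ)) (fun m _ => by positivity)
      (Finset.mem_range.2 (by nlinarith : k < k + c * k + 1)))
    simp [mul_comm]
  have h2 : (1 + x) ^ (k + c * k) ≤ 3 ^ k := by
    have h3 : (1 + x) ^ (1 + c) ≤ 3 := by
      have h4 : (1 + x) ^ (1 + c) ≤ (Real.exp x) ^ (1 + c) :=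
        pow_le_pow_left₀ (by positivity) (by linarith [Real.add_one_le_exp x]) _
      rw [← Real.exp_nat_mul] at h4
      have h5 : ((1 + c : ℕ) : ℝ) * x = 1 := by
        rw [hx]; push_cast; field_simp
      rw [h5] at h4
      linarith [Real.exp_one_lt_d9]
    have : k + c * k = (1 + c) * k := by ring
    rw [this, pow_mul]
    exact pow_le_pow_left₀ (by positivity) h3 _
  have h6 : x ^ k * (1 + c : ℝ) ^ k = 1 := by
    rw [← mul_pow, hx, inv_mul_cancel₀ (by positivity), one_pow]
  rw [hsymm, mul_pow]
  calc ((k + c * k).choose k : ℝ) = ((k + c * k).choose k : ℝ) * x ^ k * (1 + c) ^ k := by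
        rw [mul_assoc, h6, mul_one]
    _ ≤ 3 ^ k * (1 + c) ^ k := by gcongr; exact h1.trans h2

/-- **Norming sets.** For polynomials `h a` of degree `d`, normalized by a weight `ρ`, there is a
finite set of points, common to all `a`, that determines each supremum over `S` up to a factor `3`.
Its size depends only on `d` and the number of variables. The proof applies `exists_fekete_points`
to the span of the powers `(h a / ρ) ^ D`, whose dimension is `exp (O(card ι * log d))` for
`D = 8 * d * card ι`; taking `D`-th roots turns the dimension into a constant factor. -/
lemma exists_norming_finset {ι 𝒜 : Type*} [Fintype ι] [Nonempty ι] {d : ℕ} (hd : 1 ≤ d)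
    (h : 𝒜 → (ι → ℝ) → ℝ) (hh : ∀ a, h a ∈ polyDeg ι d) (ρ : (ι → ℝ) → ℝ) (S : Set (ι → ℝ))
    (hρ : ∀ θ ∈ S, 0 < ρ θ) (hb : ∀ a, ∃ C, ∀ θ ∈ S, |h a θ| ≤ C * ρ θ) :
    ∃ J : Finset (ι → ℝ), (∀ θ ∈ J, θ ∈ S) ∧
      (J.card : ℝ) ≤ (27 * (d : ℝ) ^ 2) ^ Fintype.card ι ∧
      ∀ a, ∀ b : ℝ, 0 ≤ b → (∀ θ ∈ J, |h a θ| ≤ b * ρ θ) → ∀ θ ∈ S, |h a θ| ≤ 3 * b * ρ θ := by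
  classical
  set k := Fintype.card ι with hk
  have hk1 : 1 ≤ k := Fintype.card_pos
  have hd1 : (1 : ℝ) ≤ d := by exact_mod_cast hd
  set D := 8 * d * k with hD
  have hD0 : D ≠ 0 := by positivity
  let w : 𝒜 → S → ℝ := fun a θ => (h a θ / ρ θ) ^ D
  let F : Submodule ℝ (S → ℝ) := Submodule.span ℝ (Set.range w)
  let L : ((ι → ℝ) → ℝ) →ₗ[ℝ] (S → ℝ) :=
    { toFun := fun g θ => g θ / ρ θ ^ D
      map_add' := fun f g => by ext θ; simp [add_div]
      map_smul' := fun c g => by ext θ; simp [mul_div_assoc] }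
  have hFL : F ≤ (polyDeg ι (d * D)).map L := by
    refine Submodule.span_le.2 ?_
    rintro _ ⟨a, rfl⟩
    exact ⟨_, polyDeg_pow (hh a) D, by ext θ; simp [L, w, div_pow]⟩
  have : FiniteDimensional ℝ F := Submodule.finiteDimensional_of_le hFL
  have hdim : Module.finrank ℝ F ≤ (k + d * D).choose (d * D) :=
    (Submodule.finrank_mono hFL).trans
      ((Submodule.finrank_map_le _ _).trans (finrank_polyDeg_le ι _))
  have hdim1 : (Module.finrank ℝ F : ℝ) ≤ (3 * (1 + 8 * (d : ℝ) ^ 2)) ^ k := by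
    have h1 := choose_mul_le_pow k (8 * d ^ 2) (by nlinarith)
    have h2 : d * D = 8 * d ^ 2 * k := by rw [hD]; ring
    rw [h2] at hdim
    calc (Module.finrank ℝ F : ℝ) ≤ ((k + 8 * d ^ 2 * k).choose (8 * d ^ 2 * k) : ℝ) := by
          exact_mod_cast hdim
      _ ≤ _ := h1
      _ = _ := by push_cast; ring
  have hbF : ∀ g ∈ F, ∃ C, ∀ θ, |g θ| ≤ C := by
    intro g hg
    induction hg using Submodule.span_induction with
    | mem g hg =>
      obtain ⟨a, rfl⟩ := hg
      obtain ⟨C, hC⟩ := hb a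
      refine ⟨C ^ D, fun θ => ?_⟩
      rw [abs_pow, abs_div, abs_of_pos (hρ θ θ.2)]
      exact pow_le_pow_left₀ (div_nonneg (abs_nonneg _) (hρ _ (Subtype.prop _)).le)
        ((div_le_iff₀ (hρ θ θ.2)).2 (hC θ θ.2)) _
    | zero => exact ⟨0, by simp⟩
    | add f g _ _ hf hg =>
      obtain ⟨C, hC⟩ := hf
      obtain ⟨C', hC'⟩ := hg
      exact ⟨C + C', fun θ => (abs_add_le _ _).trans (add_le_add (hC θ) (hC' θ))⟩
    | smul c g _ hg =>
      obtain ⟨C, hC⟩ := hg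
      exact ⟨|c| * C, fun θ => by
        simpa [abs_mul] using mul_le_mul_of_nonneg_left (hC θ) (abs_nonneg c)⟩
  obtain ⟨u, hu⟩ := exists_fekete_points F hbF
  refine ⟨Finset.univ.image fun j => (u j : ι → ℝ), ?_, ?_, ?_⟩
  · simp only [Finset.mem_image]
    rintro _ ⟨j, -, rfl⟩
    exact (u j).2
  · have h1 : ((Finset.univ.image fun j => (u j : ι → ℝ)).card : ℝ) ≤ Module.finrank ℝ F := by
      exact_mod_cast Finset.card_image_le.trans (by simp)
    refine h1.trans (hdim1.trans (pow_le_pow_left₀ (by positivity) ?_ _))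
    nlinarith
  · intro a b hb0 hJ θ hθ
    have h1 := hu _ (Submodule.subset_span ⟨a, rfl⟩) ⟨θ, hθ⟩
    have h2 : ∀ j, |w a (u j)| ≤ b ^ D := by
      intro j
      have := hJ (u j) (Finset.mem_image_of_mem _ (Finset.mem_univ j))
      simp only [w]
      rw [abs_pow, abs_div, abs_of_pos (hρ _ (u j).2)]
      exact pow_le_pow_left₀ (div_nonneg (abs_nonneg _) (hρ _ (Subtype.prop _)).le)
        ((div_le_iff₀ (hρ _ (u j).2)).2 this) _
    have h3 : |w a ⟨θ, hθ⟩| ≤ 2 * (Module.finrank ℝ F * b ^ D) := by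
      refine h1.trans (mul_le_mul_of_nonneg_left ?_ zero_le_two)
      simpa using Finset.sum_le_sum fun j (_ : j ∈ Finset.univ) => h2 j
    have h4 : 2 * (Module.finrank ℝ F : ℝ) ≤ 3 ^ D := by
      calc 2 * (Module.finrank ℝ F : ℝ) ≤ 2 ^ k * (3 * (1 + 8 * (d : ℝ) ^ 2)) ^ k := by
            gcongr
            exact le_self_pow₀ one_le_two (by omega)
        _ = (2 * (3 * (1 + 8 * (d : ℝ) ^ 2))) ^ k := by rw [mul_pow 2]
        _ ≤ (3 ^ (8 * d)) ^ k := by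
            refine pow_le_pow_left₀ (by positivity) ?_ _
            have h5 : 1 + (d : ℝ) * 2 ≤ (1 + 2) ^ d := by
              have := one_add_mul_le_pow (a := (2 : ℝ)) (by norm_num) d
              linarith
            have h6 : (3 : ℝ) ^ (8 * d) = ((1 + 2) ^ d) ^ 8 := by
              rw [mul_comm, pow_mul]; norm_num
            rw [h6]
            have h7 : (1 + (d : ℝ) * 2) ^ 8 ≤ ((1 + 2) ^ d) ^ 8 :=
              pow_le_pow_left₀ (by positivity) h5 _
            have h8 : (1 + (d : ℝ) * 2) ^ 2 * 3 ^ 6 ≤ (1 + (d : ℝ) * 2) ^ 8 := by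
              rw [show (1 + (d : ℝ) * 2) ^ 8 = (1 + (d : ℝ) * 2) ^ 2 * (1 + (d : ℝ) * 2) ^ 6 by
                ring]
              gcongr
              linarith
            nlinarith
        _ = 3 ^ D := by rw [← pow_mul]
    have h9 : (|h a θ| / ρ θ) ^ D ≤ (3 * b) ^ D := by
      have : |w a ⟨θ, hθ⟩| = (|h a θ| / ρ θ) ^ D := by
        simp only [w]; rw [abs_pow, abs_div, abs_of_pos (hρ θ hθ)]
      rw [← this, mul_pow]
      refine h3.trans ?_
      rw [← mul_assoc]
      gcongr
    have h10 := (pow_le_pow_iff_left₀ (div_nonneg (abs_nonneg _) (hρ θ hθ).le)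
      (by positivity) hD0).1 h9
    exact (div_le_iff₀ (hρ θ hθ)).1 h10

/-! ### Exponential moments of squares of sub-Gaussian variables -/

lemma lintegral_exp_quadratic {K : ℝ} (hK : 0 < K) (c : ℝ) :
    ∫⁻ z : ℝ, ENNReal.ofReal (Real.exp (-K * (z - c) ^ 2)) = ENNReal.ofReal √(Real.pi / K) := by
  rw [lintegral_sub_right_eq_self (fun z : ℝ => ENNReal.ofReal (Real.exp (-K * z ^ 2))) c,
    ← integral_gaussian, ofReal_integral_eq_lintegral_ofReal (integrable_exp_neg_mul_sq hK)]
  exact Filter.Eventually.of_forall fun _ => (Real.exp_pos _).le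

/-- Gaussian averaging: `exp (x² / (4K))` is a mixture over `z` of the exponentials `exp (z x)`, to
which the sub-Gaussian bound applies. -/
lemma lintegral_exp_sq_le {Ω : Type*} [MeasurableSpace Ω] {μ : Measure Ω} [SFinite μ] {g : Ω → ℝ}
    {K : ℝ} (hK : 0 < K) (hg : HasSubgaussianMGF g (Real.toNNReal K) μ) :
    ∫⁻ ω, ENNReal.ofReal (Real.exp (g ω ^ 2 / (4 * K))) ∂μ ≤ ENNReal.ofReal √2 := by
  wlog hm : Measurable g generalizing g
  · have h1 := this (hg.congr hg.aemeasurable.ae_eq_mk) hg.aemeasurable.measurable_mk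
    refine le_trans (le_of_eq (lintegral_congr_ae ?_)) h1
    filter_upwards [hg.aemeasurable.ae_eq_mk] with ω hω
    rw [hω]
  set I := ∫⁻ ω, ENNReal.ofReal (Real.exp (g ω ^ 2 / (4 * K))) ∂μ with hI
  have hC : ENNReal.ofReal √(Real.pi / K) ≠ 0 := by
    have : 0 < √(Real.pi / K) := Real.sqrt_pos.2 (by positivity)
    simpa using this
  have h1 : I * ENNReal.ofReal √(Real.pi / K) =
      ∫⁻ z : ℝ, ∫⁻ ω, ENNReal.ofReal (Real.exp (-K * z ^ 2 + z * g ω)) ∂μ := by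
    rw [hI, ← lintegral_mul_const' _ _ ENNReal.ofReal_ne_top]
    have : ∀ ω, ENNReal.ofReal (Real.exp (g ω ^ 2 / (4 * K))) * ENNReal.ofReal √(Real.pi / K) =
        ∫⁻ z : ℝ, ENNReal.ofReal (Real.exp (-K * z ^ 2 + z * g ω)) := by
      intro ω
      rw [← lintegral_exp_quadratic hK (g ω / (2 * K)),
        ← lintegral_const_mul' _ _ ENNReal.ofReal_ne_top]
      refine lintegral_congr fun z => ?_
      rw [← ENNReal.ofReal_mul (Real.exp_pos _).le, ← Real.exp_add]
      congr 2
      field_simp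
      ring
    simp_rw [this]
    rw [lintegral_lintegral_swap]
    refine Measurable.aemeasurable ?_
    fun_prop
  have h2 : ∀ z : ℝ, ∫⁻ ω, ENNReal.ofReal (Real.exp (-K * z ^ 2 + z * g ω)) ∂μ ≤
      ENNReal.ofReal (Real.exp (-(K / 2) * (z - 0) ^ 2)) := by
    intro z
    simp_rw [Real.exp_add, ENNReal.ofReal_mul (Real.exp_pos _).le]
    rw [lintegral_const_mul' _ _ ENNReal.ofReal_ne_top,
      ← ofReal_integral_eq_lintegral_ofReal (hg.integrable_exp_mul z)
        (Filter.Eventually.of_forall fun _ => (Real.exp_pos _).le),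
      ← ENNReal.ofReal_mul (Real.exp_pos _).le]
    refine ENNReal.ofReal_le_ofReal ?_
    have h3 := hg.mgf_le z
    rw [Real.coe_toNNReal _ hK.le] at h3
    refine (mul_le_mul_of_nonneg_left h3 (Real.exp_pos _).le).trans (le_of_eq ?_)
    rw [← Real.exp_add]
    ring_nf
  have h4 : I * ENNReal.ofReal √(Real.pi / K) ≤
      ENNReal.ofReal √2 * ENNReal.ofReal √(Real.pi / K) := by
    rw [h1]
    refine (lintegral_mono h2).trans (le_of_eq ?_)
    rw [lintegral_exp_quadratic (half_pos hK), ← ENNReal.ofReal_mul (Real.sqrt_nonneg _),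
      ← Real.sqrt_mul zero_le_two]
    congr 2
    field_simp
  exact (ENNReal.mul_le_mul_iff_left hC ENNReal.ofReal_ne_top).1 h4

lemma exp_le_one_add_add_sq_mul_exp_abs (y : ℝ) :
    Real.exp y ≤ 1 + y + y ^ 2 * Real.exp |y| := by
  have h1 : Real.exp y - 1 ≤ y * Real.exp y := by
    have := Real.add_one_le_exp (-y)
    have h2 : Real.exp (-y) * Real.exp y = 1 := by rw [← Real.exp_add]; simp
    nlinarith [Real.exp_pos y]
  rcases le_total 0 y with hy | hy
  · rw [abs_of_nonneg hy]
    nlinarith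
  · rw [abs_of_nonpos hy]
    have h3 := Real.add_one_le_exp y
    have h4 : 1 ≤ Real.exp (-y) := Real.one_le_exp (by linarith)
    nlinarith [sq_nonneg y]

lemma exp_mul_sub_one_le {K l x : ℝ} (hK : 1 ≤ K) (hl : |l| ≤ 1 / (8 * K)) (hx : 0 ≤ x) :
    Real.exp (l * (x - 1)) ≤
      1 + l * (x - 1) + 387 * (l ^ 2 * K ^ 2) * Real.exp (x / (4 * K)) := by
  have hK0 : 0 < K := by linarith
  refine (exp_le_one_add_add_sq_mul_exp_abs _).trans ?_
  set u := x / (8 * K) with hu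
  have hu0 : 0 ≤ u := by positivity
  have hxu : x = 8 * K * u := by rw [hu]; field_simp
  have h1 : |l * (x - 1)| ≤ 1 + u := by
    rw [abs_mul]
    calc |l| * |x - 1| ≤ 1 / (8 * K) * (x + 1) := by
          refine mul_le_mul hl ?_ (abs_nonneg _) (by positivity)
          rw [abs_le]; constructor <;> linarith
      _ = u + 1 / (8 * K) := by rw [hu]; ring
      _ ≤ 1 + u := by
          have : 1 / (8 * K) ≤ 1 := by rw [div_le_one (by positivity)]; linarith
          linarith
  have h2 : Real.exp |l * (x - 1)| ≤ 3 * Real.exp u := by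
    refine (Real.exp_le_exp.2 h1).trans ?_
    rw [Real.exp_add]
    have := Real.exp_one_lt_d9
    gcongr
    linarith
  have h3 : (x - 1) ^ 2 ≤ 129 * K ^ 2 * Real.exp u := by
    have h4 := Real.quadratic_le_exp_of_nonneg hu0
    have h5 : (x - 1) ^ 2 ≤ x ^ 2 + 1 := by nlinarith
    have h6 : (1 : ℝ) ≤ K ^ 2 := by nlinarith
    have h7 : x ^ 2 + 1 ≤ K ^ 2 * (64 * u ^ 2 + 1) := by rw [hxu]; nlinarith
    have h8 : 64 * u ^ 2 + 1 ≤ 129 * Real.exp u := by nlinarith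
    nlinarith
  have h9 : Real.exp (x / (4 * K)) = Real.exp u * Real.exp u := by
    rw [← Real.exp_add]; congr 1; rw [hxu]; field_simp; ring
  rw [h9, mul_pow]
  have h10 : l ^ 2 * (x - 1) ^ 2 * Real.exp |l * (x - 1)| ≤
      l ^ 2 * (129 * K ^ 2 * Real.exp u) * (3 * Real.exp u) := by
    gcongr
  linarith

lemma integral_exp_sq_sub_one_le {Ω : Type*} [MeasurableSpace Ω] {μ : Measure Ω}
    [IsProbabilityMeasure μ] {g : Ω → ℝ} {K : ℝ} (hK : 1 ≤ K)
    (hg : HasSubgaussianMGF g (Real.toNNReal K) μ) (h1 : ∫ ω, g ω ^ 2 ∂μ = 1) {l : ℝ}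
    (hl : |l| ≤ 1 / (8 * K)) :
    Integrable (fun ω => Real.exp (l * (g ω ^ 2 - 1))) μ ∧
      ∫ ω, Real.exp (l * (g ω ^ 2 - 1)) ∂μ ≤ Real.exp (600 * (l ^ 2 * K ^ 2)) := by
  have hK0 : 0 < K := by linarith
  have hgm := hg.aemeasurable
  have hL := lintegral_exp_sq_le hK0 hg
  have hint : Integrable (fun ω => Real.exp (g ω ^ 2 / (4 * K))) μ := by
    refine (lintegral_ofReal_ne_top_iff_integrable (by fun_prop)
      (Filter.Eventually.of_forall fun _ => (Real.exp_pos _).le)).1 ?_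
    exact (hL.trans_lt ENNReal.ofReal_lt_top).ne
  have hle : ∫ ω, Real.exp (g ω ^ 2 / (4 * K)) ∂μ ≤ 3 / 2 := by
    rw [← ofReal_integral_eq_lintegral_ofReal hint
      (Filter.Eventually.of_forall fun _ => (Real.exp_pos _).le)] at hL
    refine ((ENNReal.ofReal_le_ofReal_iff (Real.sqrt_nonneg _)).1 hL).trans ?_
    rw [Real.sqrt_le_left (by norm_num)]
    norm_num
  have hsq : Integrable (fun ω => g ω ^ 2) μ := (hg.memLp 2).integrable_sq
  have hdom : Integrable (fun ω => 1 + l * (g ω ^ 2 - 1) +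
      387 * (l ^ 2 * K ^ 2) * Real.exp (g ω ^ 2 / (4 * K))) μ := by
    fun_prop
  have hpt : ∀ ω, Real.exp (l * (g ω ^ 2 - 1)) ≤ 1 + l * (g ω ^ 2 - 1) +
      387 * (l ^ 2 * K ^ 2) * Real.exp (g ω ^ 2 / (4 * K)) := fun ω =>
    exp_mul_sub_one_le hK hl (sq_nonneg _)
  have hI : Integrable (fun ω => Real.exp (l * (g ω ^ 2 - 1))) μ := by
    refine hdom.mono (by fun_prop) (Filter.Eventually.of_forall fun ω => ?_)
    rw [Real.norm_eq_abs, abs_of_pos (Real.exp_pos _)]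
    exact (hpt ω).trans (le_abs_self _)
  refine ⟨hI, (integral_mono hI hdom hpt).trans ?_⟩
  rw [integral_add (by fun_prop) (by fun_prop), integral_add (by fun_prop) (by fun_prop),
    integral_const_mul, integral_const_mul, integral_sub hsq (by fun_prop), h1]
  simp only [integral_const, probReal_univ, smul_eq_mul, mul_one, sub_self, mul_zero, add_zero]
  have h2 := Real.add_one_le_exp (600 * (l ^ 2 * K ^ 2))
  have h3 : 387 * (l ^ 2 * K ^ 2) * ∫ ω, Real.exp (g ω ^ 2 / (4 * K)) ∂μ ≤
      387 * (l ^ 2 * K ^ 2) * (3 / 2) := by gcongr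
  have h4 : 0 ≤ l ^ 2 * K ^ 2 := by positivity
  linarith

/-- The squared norm of a vector whose coordinates `Y a` are sub-Gaussian with parameter
`K E (Y a)²`, divided by its expectation `v`. It is a convex combination of the normalized squares
of the coordinates, so Jensen's inequality reduces the bound to a single coordinate. No
independence of the coordinates is needed. -/
lemma integral_exp_sum_sq_le {Ω α : Type*} [Fintype α] [MeasurableSpace Ω] {μ : Measure Ω}
    [IsProbabilityMeasure μ] {Y : α → Ω → ℝ} {K v : ℝ} (hK : 1 ≤ K)
    (hY : ∀ a, HasSubgaussianMGF (Y a) (Real.toNNReal (K * ∫ ω, Y a ω ^ 2 ∂μ)) μ)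
    (hv : v = ∑ a, ∫ ω, Y a ω ^ 2 ∂μ) (hv0 : 0 < v) {l : ℝ} (hl : |l| ≤ 1 / (8 * K)) :
    Integrable (fun ω => Real.exp (l * ((∑ a, Y a ω ^ 2) / v - 1))) μ ∧
      ∫ ω, Real.exp (l * ((∑ a, Y a ω ^ 2) / v - 1)) ∂μ ≤ Real.exp (600 * (l ^ 2 * K ^ 2)) := by
  set w : α → ℝ := fun a => ∫ ω, Y a ω ^ 2 ∂μ with hw
  have hw0 : ∀ a, 0 ≤ w a := fun a => integral_nonneg fun _ => sq_nonneg _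
  have hYm : ∀ a, AEMeasurable (Y a) μ := fun a => (hY a).aemeasurable
  have hone : ∑ a, w a / v = 1 := by rw [← Finset.sum_div, ← hv, div_self hv0.ne']
  have hcoord : ∀ a, Integrable (fun ω => w a / v * Real.exp (l * (Y a ω ^ 2 / w a - 1))) μ ∧
      ∫ ω, w a / v * Real.exp (l * (Y a ω ^ 2 / w a - 1)) ∂μ ≤
        w a / v * Real.exp (600 * (l ^ 2 * K ^ 2)) := by
    intro a
    rcases (hw0 a).eq_or_lt with h0 | hpos
    · simp [← h0]
    · have hs : 0 < √(w a) := Real.sqrt_pos.2 hpos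
      have hg : HasSubgaussianMGF (fun ω => (√(w a))⁻¹ * Y a ω) (Real.toNNReal K) μ := by
        have h1 := (hY a).const_mul (√(w a))⁻¹
        convert h1 using 1
        refine NNReal.eq ?_
        change _ = (√(w a))⁻¹ ^ 2 * ((Real.toNNReal (K * w a) : ℝ≥0) : ℝ)
        rw [Real.coe_toNNReal _ (by positivity), Real.coe_toNNReal _ (by positivity), inv_pow,
          Real.sq_sqrt (hw0 a)]
        field_simp
      have hsq : ∀ ω, ((√(w a))⁻¹ * Y a ω) ^ 2 = Y a ω ^ 2 / w a := by
        intro ω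
        rw [mul_pow, inv_pow, Real.sq_sqrt (hw0 a)]
        field_simp
      have h3 := integral_exp_sq_sub_one_le (l := l) hK hg (by
        simp_rw [hsq]
        rw [integral_div]
        exact div_self hpos.ne') hl
      simp_rw [hsq] at h3
      refine ⟨h3.1.const_mul _, ?_⟩
      rw [integral_const_mul]
      exact mul_le_mul_of_nonneg_left h3.2 (by positivity)
  have hae : ∀ᵐ ω ∂μ, ∀ a, w a = 0 → Y a ω = 0 := by
    rw [ae_all_iff]
    intro a
    by_cases h0 : w a = 0
    · have h1 := hY a
      have h2 : Real.toNNReal (K * ∫ ω, Y a ω ^ 2 ∂μ) = 0 := by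
        have : ∫ ω, Y a ω ^ 2 ∂μ = 0 := h0
        simp [this]
      rw [h2] at h1
      filter_upwards [h1.ae_eq_zero_of_hasSubgaussianMGF_zero] with ω hω _
      exact hω
    · exact Filter.Eventually.of_forall fun ω h => absurd h h0
  have hpt : ∀ᵐ ω ∂μ, Real.exp (l * ((∑ a, Y a ω ^ 2) / v - 1)) ≤
      ∑ a, w a / v * Real.exp (l * (Y a ω ^ 2 / w a - 1)) := by
    filter_upwards [hae] with ω hω
    have h1 : l * ((∑ a, Y a ω ^ 2) / v - 1) =
        ∑ a, (w a / v) • (l * (Y a ω ^ 2 / w a - 1)) := by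
      have h2 : ∀ a, (w a / v) • (l * (Y a ω ^ 2 / w a - 1)) =
          l * (Y a ω ^ 2 / v) - l * (w a / v) := by
        intro a
        by_cases h0 : w a = 0
        · simp [h0, hω a h0]
        · rw [smul_eq_mul]; field_simp
      simp_rw [h2]
      rw [Finset.sum_sub_distrib, ← Finset.mul_sum, ← Finset.mul_sum, hone, ← Finset.sum_div]
      ring
    rw [h1]
    exact convexOn_exp.map_sum_le (fun a _ => div_nonneg (hw0 a) hv0.le) hone
      fun _ _ => Set.mem_univ _
  have hdom : Integrable
      (fun ω => ∑ a, w a / v * Real.exp (l * (Y a ω ^ 2 / w a - 1))) μ :=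
    integrable_finsetSum _ fun a _ => (hcoord a).1
  have hI : Integrable (fun ω => Real.exp (l * ((∑ a, Y a ω ^ 2) / v - 1))) μ := by
    refine hdom.mono (by fun_prop) ?_
    filter_upwards [hpt] with ω hω
    rw [Real.norm_eq_abs, abs_of_pos (Real.exp_pos _)]
    exact hω.trans (le_abs_self _)
  refine ⟨hI, (integral_mono_ae hI hdom hpt).trans ?_⟩
  rw [integral_finsetSum _ fun a _ => (hcoord a).1]
  refine (Finset.sum_le_sum fun a _ => (hcoord a).2).trans ?_
  rw [← Finset.sum_mul, hone, one_mul]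

/-! ### Chernoff bounds for independent observations -/

lemma measureReal_le_sum_le_exp {Ω : Type*} [MeasurableSpace Ω] {μ : Measure Ω}
    [IsProbabilityMeasure μ] {T : ℕ} {W : Fin T → Ω → ℝ} (hind : iIndepFun W μ)
    (hm : ∀ t, AEMeasurable (W t) μ) {l b : ℝ} (hl : 0 ≤ l)
    (hint : ∀ t, Integrable (fun ω => Real.exp (l * W t ω)) μ)
    (hb : ∀ t, ∫ ω, Real.exp (l * W t ω) ∂μ ≤ Real.exp b) (a : ℝ) :
    μ.real {ω | a ≤ ∑ t, W t ω} ≤ Real.exp (T * b - l * a) := by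
  have h1 : mgf (∑ t, W t) μ l = ∏ t, mgf (W t) μ l := hind.mgf_sum₀ hm _
  have hpos : 0 < mgf (∑ t, W t) μ l := by
    rw [h1]
    exact Finset.prod_pos fun t _ => mgf_pos (hint t)
  have h2 : mgf (∑ t, W t) μ l ≤ Real.exp (T * b) := by
    rw [h1, Real.exp_nat_mul]
    refine (Finset.prod_le_prod (fun t _ => mgf_nonneg) fun t _ => hb t).trans ?_
    simp
  have h3 := measure_ge_le_exp_mul_mgf (μ := μ) (X := ∑ t, W t) a hl
    (Integrable.of_integral_ne_zero hpos.ne')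
  have h4 : {ω | a ≤ ∑ t, W t ω} = {ω | a ≤ (∑ t, W t) ω} := by
    ext ω; simp [Finset.sum_apply]
  rw [h4]
  refine h3.trans ?_
  rw [show T * b - l * a = -l * a + T * b by ring, Real.exp_add]
  gcongr

/-- Concentration of an average of independent variables `Z t` with mean `1` whose centred moment
generating functions are sub-exponential at scale `K`. -/
lemma measureReal_abs_sum_sub_one_le {Ω : Type*} [MeasurableSpace Ω] {μ : Measure Ω}
    [IsProbabilityMeasure μ] {T : ℕ} {Z : Fin T → Ω → ℝ} (hind : iIndepFun Z μ)
    (hm : ∀ t, AEMeasurable (Z t) μ) {K : ℝ} (hK : 1 ≤ K)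
    (hZ : ∀ t, ∀ l : ℝ, |l| ≤ 1 / (8 * K) → Integrable (fun ω => Real.exp (l * (Z t ω - 1))) μ ∧
      ∫ ω, Real.exp (l * (Z t ω - 1)) ∂μ ≤ Real.exp (600 * (l ^ 2 * K ^ 2))) :
    μ.real {ω | (T : ℝ) / 6 ≤ |∑ t, (Z t ω - 1)|} ≤ 2 * Real.exp (-(T / (86400 * K ^ 2))) := by
  have hK0 : 0 < K := by linarith
  -- The value of `l` minimizing `600 l² K² - l / 6`.
  set l : ℝ := 1 / (7200 * K ^ 2) with hl
  have hl0 : 0 ≤ l := by positivity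
  have hlK : |l| ≤ 1 / (8 * K) := by
    rw [abs_of_nonneg hl0, hl]
    refine one_div_le_one_div_of_le (by positivity) ?_
    nlinarith
  have hexp : (T : ℝ) * (600 * (l ^ 2 * K ^ 2)) - l * (T / 6) = -(T / (86400 * K ^ 2)) := by
    rw [hl]; field_simp; ring
  have hup : μ.real {ω | (T : ℝ) / 6 ≤ ∑ t, (Z t ω - 1)} ≤ Real.exp (-(T / (86400 * K ^ 2))) := by
    rw [← hexp]
    refine measureReal_le_sum_le_exp (W := fun t ω => Z t ω - 1)
      (hind.comp (fun _ x => x - 1) fun _ => by fun_prop) (fun t => by fun_prop) hl0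
      (fun t => (hZ t l hlK).1) (fun t => (hZ t l hlK).2) _
  have hlow : μ.real {ω | (T : ℝ) / 6 ≤ ∑ t, -(Z t ω - 1)} ≤
      Real.exp (-(T / (86400 * K ^ 2))) := by
    rw [← hexp]
    have hneg : ∀ t ω, l * -(Z t ω - 1) = -l * (Z t ω - 1) := fun t ω => by ring
    refine measureReal_le_sum_le_exp (W := fun t ω => -(Z t ω - 1))
      (hind.comp (fun _ x => -(x - 1)) fun _ => by fun_prop) (fun t => by fun_prop) hl0
      (fun t => ?_) (fun t => ?_) _
    · simp_rw [hneg]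
      exact (hZ t (-l) (by rwa [abs_neg])).1
    · simp_rw [hneg]
      simpa using (hZ t (-l) (by rwa [abs_neg])).2
  have hsub : {ω | (T : ℝ) / 6 ≤ |∑ t, (Z t ω - 1)|} ⊆
      {ω | (T : ℝ) / 6 ≤ ∑ t, (Z t ω - 1)} ∪ {ω | (T : ℝ) / 6 ≤ ∑ t, -(Z t ω - 1)} := by
    intro ω hω
    rw [Set.mem_ofPred_eq, le_abs] at hω
    simpa [Finset.sum_neg_distrib] using hω
  calc _ ≤ _ := measureReal_mono hsub
    _ ≤ _ := measureReal_union_le _ _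
    _ ≤ _ := by linarith

/-! ### The conditionally sub-Gaussian error -/

/-- The conditional bound holds for each fixed direction almost surely; a countable dense set of
directions and Fatou's lemma make it hold for a direction that depends on the covariate. -/
lemma ErrorAssumption.integral_exp_inner_le {ι ι' Ω : Type*} [Fintype ι] [Fintype ι']
    [MeasurableSpace Ω] {μ : Measure Ω} [IsProbabilityMeasure μ] {x : Ω → EuclideanSpace ℝ ι}
    {e : Ω → EuclideanSpace ℝ ι'} {κ : ℝ} (h : ErrorAssumption x e κ μ) (hx : AEMeasurable x μ)
    (he : AEMeasurable e μ) {φ : EuclideanSpace ℝ ι → EuclideanSpace ℝ ι'} (hφ : Measurable φ) :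
    Integrable (fun ω => Real.exp (inner ℝ (φ (x ω)) (e ω) - κ ^ 2 * ‖φ (x ω)‖ ^ 2 / 2)) μ ∧
      ∫ ω, Real.exp (inner ℝ (φ (x ω)) (e ω) - κ ^ 2 * ‖φ (x ω)‖ ^ 2 / 2) ∂μ ≤ 1 := by
  have hdense : ∀ᵐ v ∂(μ.map x), ∀ k : ℕ,
      ∫⁻ w, ENNReal.ofReal (Real.exp (inner ℝ (TopologicalSpace.denseSeq _ k) w))
        ∂(condDistrib e x μ v) ≤
      ENNReal.ofReal (Real.exp (κ ^ 2 * ‖TopologicalSpace.denseSeq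
        (EuclideanSpace ℝ ι') k‖ ^ 2 / 2)) := by
    rw [ae_all_iff]
    intro k
    filter_upwards [(h.subGaussian (TopologicalSpace.denseSeq _ k)).ae_forall_integrable_exp_mul,
      (h.subGaussian (TopologicalSpace.denseSeq _ k)).mgf_le] with v hv1 hv2
    have h1 := hv1 1
    have h2 := hv2 1
    simp only [one_mul, mgf] at h1 h2
    rw [← ofReal_integral_eq_lintegral_ofReal h1
      (Filter.Eventually.of_forall fun _ => (Real.exp_pos _).le)]
    refine ENNReal.ofReal_le_ofReal (h2.trans (le_of_eq ?_))
    rw [Real.coe_toNNReal _ (by positivity)]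
    ring_nf
  have hall : ∀ᵐ v ∂(μ.map x), ∀ u : EuclideanSpace ℝ ι',
      ∫⁻ w, ENNReal.ofReal (Real.exp (inner ℝ u w)) ∂(condDistrib e x μ v) ≤
      ENNReal.ofReal (Real.exp (κ ^ 2 * ‖u‖ ^ 2 / 2)) := by
    filter_upwards [hdense] with v hv u
    obtain ⟨s, hs, hlim⟩ := mem_closure_iff_seq_limit.1
      ((TopologicalSpace.denseRange_denseSeq (EuclideanSpace ℝ ι')) u)
    have hl1 : ∀ w, Filter.Tendsto (fun k => ENNReal.ofReal (Real.exp (inner ℝ (s k) w)))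
        Filter.atTop (nhds (ENNReal.ofReal (Real.exp (inner ℝ u w)))) := fun w =>
      ENNReal.tendsto_ofReal (((Real.continuous_exp.tendsto _).comp
        (hlim.inner tendsto_const_nhds)))
    have hl2 : Filter.Tendsto (fun k => ENNReal.ofReal (Real.exp (κ ^ 2 * ‖s k‖ ^ 2 / 2)))
        Filter.atTop (nhds (ENNReal.ofReal (Real.exp (κ ^ 2 * ‖u‖ ^ 2 / 2)))) :=
      ENNReal.tendsto_ofReal ((Real.continuous_exp.tendsto _).comp
        (((hlim.norm.pow 2).const_mul _).div_const _))
    have hle : ∀ k, ∫⁻ w, ENNReal.ofReal (Real.exp (inner ℝ (s k) w)) ∂(condDistrib e x μ v) ≤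
        ENNReal.ofReal (Real.exp (κ ^ 2 * ‖s k‖ ^ 2 / 2)) := by
      intro k
      obtain ⟨j, hj⟩ := hs k
      rw [← hj]
      exact hv j
    calc ∫⁻ w, ENNReal.ofReal (Real.exp (inner ℝ u w)) ∂(condDistrib e x μ v)
        = ∫⁻ w, Filter.liminf (fun k => ENNReal.ofReal (Real.exp (inner ℝ (s k) w)))
            Filter.atTop ∂(condDistrib e x μ v) :=
          lintegral_congr fun w => (hl1 w).liminf_eq.symm
      _ ≤ Filter.liminf (fun k => ∫⁻ w, ENNReal.ofReal (Real.exp (inner ℝ (s k) w))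
            ∂(condDistrib e x μ v)) Filter.atTop := lintegral_liminf_le fun k => by fun_prop
      _ ≤ Filter.liminf (fun k => ENNReal.ofReal (Real.exp (κ ^ 2 * ‖s k‖ ^ 2 / 2)))
            Filter.atTop := Filter.liminf_le_liminf (Filter.Eventually.of_forall hle)
      _ = _ := hl2.liminf_eq
  have hF : Measurable fun z : EuclideanSpace ℝ ι × EuclideanSpace ℝ ι' =>
      ENNReal.ofReal (Real.exp (inner ℝ (φ z.1) z.2 - κ ^ 2 * ‖φ z.1‖ ^ 2 / 2)) := by
    fun_prop
  have hlint : ∫⁻ ω, ENNReal.ofReal (Real.exp (inner ℝ (φ (x ω)) (e ω) -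
      κ ^ 2 * ‖φ (x ω)‖ ^ 2 / 2)) ∂μ ≤ 1 := by
    have h1 : ∫⁻ ω, ENNReal.ofReal (Real.exp (inner ℝ (φ (x ω)) (e ω) -
        κ ^ 2 * ‖φ (x ω)‖ ^ 2 / 2)) ∂μ = ∫⁻ z, ENNReal.ofReal (Real.exp (inner ℝ (φ z.1) z.2 -
          κ ^ 2 * ‖φ z.1‖ ^ 2 / 2)) ∂(μ.map fun ω => (x ω, e ω)) :=
      (lintegral_map' hF.aemeasurable (hx.prodMk he)).symm
    have := Measure.isProbabilityMeasure_map hx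
    rw [h1, ← compProd_map_condDistrib he, Measure.lintegral_compProd hF]
    calc _ ≤ ∫⁻ _, 1 ∂(μ.map x) := lintegral_mono_ae ?_
      _ = 1 := by simp
    filter_upwards [hall] with v hv
    simp_rw [sub_eq_add_neg, Real.exp_add, ENNReal.ofReal_mul (Real.exp_pos _).le]
    rw [lintegral_mul_const' _ _ ENNReal.ofReal_ne_top]
    refine (mul_le_mul_left (hv (φ v)) _).trans (le_of_eq ?_)
    rw [← ENNReal.ofReal_mul (Real.exp_pos _).le, ← Real.exp_add]
    simp
  have hm : AEMeasurable (fun ω => Real.exp (inner ℝ (φ (x ω)) (e ω) -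
      κ ^ 2 * ‖φ (x ω)‖ ^ 2 / 2)) μ := by
    have := hφ.comp_aemeasurable hx
    fun_prop
  have hI : Integrable (fun ω => Real.exp (inner ℝ (φ (x ω)) (e ω) -
      κ ^ 2 * ‖φ (x ω)‖ ^ 2 / 2)) μ :=
    (lintegral_ofReal_ne_top_iff_integrable hm.aestronglyMeasurable
      (Filter.Eventually.of_forall fun _ => (Real.exp_pos _).le)).1
      (hlint.trans_lt ENNReal.one_lt_top).ne
  refine ⟨hI, ?_⟩
  rw [← ofReal_integral_eq_lintegral_ofReal hI
    (Filter.Eventually.of_forall fun _ => (Real.exp_pos _).le)] at hlint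
  exact ENNReal.ofReal_le_one.1 hlint

/-! ### Tensors, rows and the population quadratic form -/

section Tensors

variable {n m : ℕ} {q : Fin n → ℕ} {p : Fin m → ℕ}

/-- The row of the sequential matricization of `D` at the multi-index `a`. -/
def tensorRow (D : CoefTensor q p) (a : MultiIdx q) : RTensor p := WithLp.toLp 2 fun b => D (a, b)

lemma contract_apply (D : CoefTensor q p) (x : RTensor p) (a : MultiIdx q) :
    contract D x a = inner ℝ (tensorRow D a) x := by
  simp [contract, tensorRow, PiLp.inner_apply, mul_comm]

lemma norm_contract_sq (D : CoefTensor q p) (x : RTensor p) :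
    ‖contract D x‖ ^ 2 = ∑ a, inner ℝ (tensorRow D a) x ^ 2 := by
  simp [EuclideanSpace.norm_sq_eq, contract_apply]

lemma norm_sq_eq_sum_tensorRow (D : CoefTensor q p) : ‖D‖ ^ 2 = ∑ a, ‖tensorRow D a‖ ^ 2 := by
  simp [EuclideanSpace.norm_sq_eq, tensorRow, Fintype.sum_prod_type]

lemma norm_contract_sq_le (D : CoefTensor q p) (x : RTensor p) :
    ‖contract D x‖ ^ 2 ≤ ‖D‖ ^ 2 * ‖x‖ ^ 2 := by
  rw [norm_contract_sq, norm_sq_eq_sum_tensorRow, Finset.sum_mul]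
  refine Finset.sum_le_sum fun a _ => ?_
  rw [← mul_pow, sq_le_sq, abs_of_nonneg (by positivity : 0 ≤ ‖tensorRow D a‖ * ‖x‖)]
  exact abs_real_inner_le_norm _ _

lemma continuous_contract (D : CoefTensor q p) : Continuous (contract D) := by
  unfold contract
  fun_prop

lemma contract_sub (A B : CoefTensor q p) (x : RTensor p) :
    contract (A - B) x = contract A x - contract B x := by
  ext a
  simp [contract, sub_mul, Finset.sum_sub_distrib]

/-- The quadratic form `tr (D M Dᵀ)` in the matricization of `D`; for the covariance matrix `M` of
a centred vector `x` it is `E ‖⟨D, x⟩‖²`. -/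
def quadVar (M : Matrix (MultiIdx p) (MultiIdx p) ℝ) (D : CoefTensor q p) : ℝ :=
  ∑ a, (tensorRow D a).ofLp ⬝ᵥ M.mulVec (tensorRow D a).ofLp

end Tensors

/-! ### Second moments of the covariates -/

lemma ProbabilityTheory.HasSubgaussianMGF.mono {Ω : Type*} [MeasurableSpace Ω] {μ : Measure Ω}
    {f : Ω → ℝ} {c c' : ℝ≥0} (h : HasSubgaussianMGF f c μ) (hc : c ≤ c') :
    HasSubgaussianMGF f c' μ where
  integrable_exp_mul := h.integrable_exp_mul
  mgf_le t := (h.mgf_le t).trans (Real.exp_le_exp.2 (by gcongr))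

lemma integral_sq_le_two_mul {Ω : Type*} [MeasurableSpace Ω] {μ : Measure Ω}
    [IsProbabilityMeasure μ] {g : Ω → ℝ} {K : ℝ} (hK : 0 < K)
    (hg : HasSubgaussianMGF g (Real.toNNReal K) μ) : ∫ ω, g ω ^ 2 ∂μ ≤ 2 * K := by
  have hL := lintegral_exp_sq_le hK hg
  have hgm := hg.aemeasurable
  have hsq : Integrable (fun ω => g ω ^ 2) μ := (hg.memLp 2).integrable_sq
  have h1 : ENNReal.ofReal (∫ ω, (g ω ^ 2 / (4 * K) + 1) ∂μ) ≤ ENNReal.ofReal √2 := by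
    rw [ofReal_integral_eq_lintegral_ofReal (by fun_prop)
      (Filter.Eventually.of_forall fun ω => by positivity)]
    exact (lintegral_mono fun ω => ENNReal.ofReal_le_ofReal (Real.add_one_le_exp _)).trans hL
  have h2 := (ENNReal.ofReal_le_ofReal_iff (Real.sqrt_nonneg _)).1 h1
  rw [integral_add (by fun_prop) (by fun_prop), integral_div] at h2
  simp only [integral_const, probReal_univ, smul_eq_mul, mul_one] at h2
  have h3 : √2 ≤ 3 / 2 := by
    rw [Real.sqrt_le_left (by norm_num)]
    norm_num
  have h4 : (∫ ω, g ω ^ 2 ∂μ) / (4 * K) ≤ 1 / 2 := by linarith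
  rw [div_le_iff₀ (by positivity)] at h4
  linarith

section Covariates

variable {ι Ω : Type*} [Fintype ι] [DecidableEq ι] [MeasurableSpace Ω] {μ : Measure Ω}
  {x : Ω → EuclideanSpace ℝ ι} {σ cx Cx : ℝ}

lemma CovariateAssumption.memLp_apply (h : CovariateAssumption x σ cx Cx μ) (i : ι) :
    MemLp (fun ω => x ω i) 2 μ := by
  have := (h.subGaussian (EuclideanSpace.single i 1)).memLp 2
  simpa [EuclideanSpace.inner_single_left] using this

lemma CovariateAssumption.covMat_apply (h : CovariateAssumption x σ cx Cx μ) (i j : ι) :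
    covMat x μ i j = ∫ ω, x ω i * x ω j ∂μ := by
  simp [covMat, covariance, h.mean_zero]

lemma CovariateAssumption.integral_inner_sq (h : CovariateAssumption x σ cx Cx μ)
    (u : EuclideanSpace ℝ ι) :
    ∫ ω, inner ℝ u (x ω) ^ 2 ∂μ = u.ofLp ⬝ᵥ (covMat x μ).mulVec u.ofLp := by
  have h1 : ∀ ω, inner ℝ u (x ω) ^ 2 = ∑ i, ∑ j, u i * (u j * (x ω i * x ω j)) := by
    intro ω
    simp only [PiLp.inner_apply, RCLike.inner_apply, conj_trivial, sq, Finset.sum_mul_sum]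
    exact Finset.sum_congr rfl fun i _ => Finset.sum_congr rfl fun j _ => by ring
  have hint : ∀ i j, Integrable (fun ω => x ω i * x ω j) μ := fun i j =>
    (h.memLp_apply i).integrable_mul (h.memLp_apply j)
  simp_rw [h1]
  rw [integral_finsetSum _ fun i _ => integrable_finsetSum _ fun j _ =>
    ((hint i j).const_mul _).const_mul _]
  simp only [dotProduct, Matrix.mulVec, h.covMat_apply]
  refine Finset.sum_congr rfl fun i _ => ?_
  rw [integral_finsetSum _ fun j _ => ((hint i j).const_mul _).const_mul _, Finset.mul_sum]
  refine Finset.sum_congr rfl fun j _ => ?_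
  rw [integral_const_mul, integral_const_mul]
  ring

lemma CovariateAssumption.mul_norm_sq_le (h : CovariateAssumption x σ cx Cx μ)
    (u : EuclideanSpace ℝ ι) : cx * ‖u‖ ^ 2 ≤ u.ofLp ⬝ᵥ (covMat x μ).mulVec u.ofLp := by
  have hH : (covMat x μ - algebraMap ℝ (Matrix ι ι ℝ) cx).IsHermitian := by
    refine Matrix.IsHermitian.sub ?_ ?_
    · ext i j
      simp [covMat, covariance_comm]
    · rw [Matrix.algebraMap_eq_diagonal]
      exact Matrix.isHermitian_diagonal _
  have hP : (covMat x μ - algebraMap ℝ (Matrix ι ι ℝ) cx).PosSemidef := by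
    rw [hH.posSemidef_iff_eigenvalues_nonneg]
    intro i
    have h1 := hH.eigenvalues_mem_spectrum_real i
    have h2 : hH.eigenvalues i + cx ∈ spectrum ℝ (covMat x μ) := by
      have := (spectrum.add_mem_add_iff (s := cx)).2 h1
      simpa using this
    have := (h.eigenvalues _ h2).1
    simpa using this
  have h3 := hP.dotProduct_mulVec_nonneg u.ofLp
  rw [Matrix.sub_mulVec, dotProduct_sub, Algebra.algebraMap_eq_smul_one, Matrix.smul_mulVec,
    Matrix.one_mulVec, dotProduct_smul] at h3
  have h4 : ‖u‖ ^ 2 = u.ofLp ⬝ᵥ u.ofLp := by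
    rw [EuclideanSpace.norm_sq_eq]
    simp [dotProduct, sq]
  simp only [star_trivial, smul_eq_mul] at h3
  rw [h4]
  linarith

lemma CovariateAssumption.cx_le_two_mul [IsProbabilityMeasure μ] [Nonempty ι]
    (h : CovariateAssumption x σ cx Cx μ)
    (hσ : 0 < σ) : cx ≤ 2 * σ ^ 2 := by
  obtain ⟨i⟩ := ‹Nonempty ι›
  have h1 := h.mul_norm_sq_le (EuclideanSpace.single i 1)
  rw [← h.integral_inner_sq] at h1
  have h2 := h.subGaussian (EuclideanSpace.single i 1)
  simp only [PiLp.norm_single, norm_one, one_pow, mul_one] at h1 h2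
  exact h1.trans (integral_sq_le_two_mul (by positivity) h2)

end Covariates

section QuadVar

variable {n m : ℕ} {q : Fin n → ℕ} {p : Fin m → ℕ} {Ω : Type*} [MeasurableSpace Ω] {μ : Measure Ω}
  {x : Ω → RTensor p} {σ cx Cx : ℝ}

lemma CovariateAssumption.mul_norm_sq_le_quadVar (h : CovariateAssumption x σ cx Cx μ)
    (D : CoefTensor q p) : cx * ‖D‖ ^ 2 ≤ quadVar (covMat x μ) D := by
  rw [norm_sq_eq_sum_tensorRow, Finset.mul_sum]
  exact Finset.sum_le_sum fun _ _ => h.mul_norm_sq_le _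

lemma CovariateAssumption.quadVar_eq (h : CovariateAssumption x σ cx Cx μ)
    (D : CoefTensor q p) :
    quadVar (covMat x μ) D = ∑ a, ∫ ω, inner ℝ (tensorRow D a) (x ω) ^ 2 ∂μ :=
  Finset.sum_congr rfl fun _ _ => (h.integral_inner_sq _).symm

end QuadVar

/-! ### The parametrization of the model -/

section Param

variable {n m : ℕ} (q : Fin n → ℕ) (p : Fin m → ℕ) (Ry Rx : ℕ)

/-- The index set of the free parameters of the class `Θ_LR`: the entries of `G`, of the factors of
`Λ_y` and of the factors of `Λ_x`. -/
abbrev ParamIdx : Type :=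
  (Fin Ry × Fin Rx) ⊕ ((Σ i, Fin (q i) × Fin Ry) ⊕ (Σ j, Fin (p j) × Fin Rx))

lemma card_paramIdx : (Fintype.card (ParamIdx q p Ry Rx) : ℝ) = dLR q p Ry Rx := by
  simp only [Fintype.card_sum, Fintype.card_prod, Fintype.card_fin, Fintype.card_sigma, dLR,
    ← Finset.sum_mul]
  push_cast
  ring

variable {q p Ry Rx}

/-- The deviation from `A` of the tensor with parameters `θ`. The unit-norm constraint on the
columns of the factors is not imposed. -/
def paramDiff (A : CoefTensor q p) (θ : ParamIdx q p Ry Rx → ℝ) : CoefTensor q p :=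
  WithLp.toLp 2 fun ab =>
    (∑ r, ∑ s, (∏ i, θ (.inr (.inl ⟨i, ab.1 i, r⟩))) * θ (.inl (r, s)) *
      ∏ j, θ (.inr (.inr ⟨j, ab.2 j, s⟩))) - A ab

lemma exists_paramDiff_eq {B : CoefTensor q p} (hB : B ∈ thetaLR q p Ry Rx) (A : CoefTensor q p) :
    ∃ θ : ParamIdx q p Ry Rx → ℝ, paramDiff A θ = B - A := by
  obtain ⟨_, ⟨U, -, rfl⟩, G, _, ⟨V, -, rfl⟩, hBG⟩ := hB
  refine ⟨Sum.elim (fun rs => G rs.1 rs.2) (Sum.elim (fun z => U z.1 z.2.1 z.2.2)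
    fun z => V z.1 z.2.1 z.2.2), ?_⟩
  ext ⟨a, b⟩
  have h1 : B (a, b) = (khatriRao U * G * (khatriRao V).transpose) a b := by
    rw [← hBG]; rfl
  simp only [paramDiff, PiLp.sub_apply, h1, Matrix.mul_apply, Sum.elim_inl, Sum.elim_inr,
    khatriRao, Matrix.transpose_apply, Matrix.of_apply, Finset.sum_mul]
  rw [Finset.sum_comm]

lemma paramDiff_mem_polyDeg (A : CoefTensor q p) (ab : MultiIdx q × MultiIdx p) :
    (fun θ : ParamIdx q p Ry Rx → ℝ => paramDiff A θ ab) ∈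
      polyDeg (ParamIdx q p Ry Rx) (n + m + 1) := by
  have h1 : (fun θ : ParamIdx q p Ry Rx → ℝ => ∑ r, ∑ s,
      (∏ i, θ (.inr (.inl ⟨i, ab.1 i, r⟩))) * θ (.inl (r, s)) *
      ∏ j, θ (.inr (.inr ⟨j, ab.2 j, s⟩))) ∈ polyDeg (ParamIdx q p Ry Rx) (n + m + 1) := by
    refine polyDeg_sum _ fun r _ => polyDeg_sum _ fun s _ => ?_
    have h2 := polyDeg_prod (Finset.univ : Finset (Fin n)) (f := fun i
      (θ : ParamIdx q p Ry Rx → ℝ) => θ (.inr (.inl ⟨i, ab.1 i, r⟩))) fun i _ => polyDeg_coord _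
    have h3 := polyDeg_prod (Finset.univ : Finset (Fin m)) (f := fun j
      (θ : ParamIdx q p Ry Rx → ℝ) => θ (.inr (.inr ⟨j, ab.2 j, s⟩))) fun i _ => polyDeg_coord _
    rw [Finset.card_univ, Fintype.card_fin] at h2 h3
    rw [show n + m + 1 = n + 1 + m by ring]
    exact polyDeg_mul (polyDeg_mul h2 (polyDeg_coord _)) h3
  exact Submodule.sub_mem _ h1 (polyDeg_const _ (A ab))

lemma contract_paramDiff_mem_polyDeg (A : CoefTensor q p) (x : RTensor p) (a : MultiIdx q) :
    (fun θ : ParamIdx q p Ry Rx → ℝ => contract (paramDiff A θ) x a) ∈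
      polyDeg (ParamIdx q p Ry Rx) (n + m + 1) := by
  rw [← add_zero (n + m + 1)]
  exact polyDeg_sum _ fun b _ =>
    polyDeg_mul (paramDiff_mem_polyDeg A (a, b)) (polyDeg_const 0 (x b))

lemma norm_contract_sq_mem_polyDeg (A : CoefTensor q p) (x : RTensor p) :
    (fun θ : ParamIdx q p Ry Rx → ℝ => ‖contract (paramDiff A θ) x‖ ^ 2) ∈
      polyDeg (ParamIdx q p Ry Rx) ((n + m + 1) * 2) := by
  simp only [EuclideanSpace.norm_sq_eq, Real.norm_eq_abs, sq_abs]
  exact polyDeg_sum _ fun a _ => polyDeg_pow (contract_paramDiff_mem_polyDeg A x a) 2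

lemma quadVar_mem_polyDeg (A : CoefTensor q p) (M : Matrix (MultiIdx p) (MultiIdx p) ℝ) :
    (fun θ : ParamIdx q p Ry Rx → ℝ => quadVar M (paramDiff A θ)) ∈
      polyDeg (ParamIdx q p Ry Rx) ((n + m + 1) * 2) := by
  rw [mul_two]
  refine polyDeg_sum _ fun a _ => polyDeg_sum _ fun b _ =>
    polyDeg_mul (paramDiff_mem_polyDeg A (a, b)) ?_
  refine polyDeg_sum _ fun b' _ => ?_
  have := polyDeg_mul (polyDeg_const 0 (M b b'))
    (paramDiff_mem_polyDeg (Ry := Ry) (Rx := Rx) A (a, b'))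
  rwa [zero_add] at this

lemma inner_contract_mem_polyDeg (A : CoefTensor q p) (x : RTensor p) (e : RTensor q) :
    (fun θ : ParamIdx q p Ry Rx → ℝ => inner ℝ (contract (paramDiff A θ) x) e) ∈
      polyDeg (ParamIdx q p Ry Rx) (n + m + 1) := by
  simp only [PiLp.inner_apply, RCLike.inner_apply, conj_trivial]
  refine polyDeg_sum _ fun a _ => ?_
  have := polyDeg_mul (polyDeg_const 0 (e a))
    (contract_paramDiff_mem_polyDeg (Ry := Ry) (Rx := Rx) A x a)
  rwa [zero_add] at this

end Param

/-! ### Tail bounds for a fixed tensor -/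

section Tails

variable {n m T : ℕ} {q : Fin n → ℕ} {p : Fin m → ℕ} {Ω : Type*} [MeasurableSpace Ω]
  {μ : Measure Ω} [IsProbabilityMeasure μ] {X : Fin T → Ω → RTensor p} {E : Fin T → Ω → RTensor q}

lemma measureReal_abs_sum_norm_contract_sq_sub_le (hind : iIndepFun X μ)
    (hX : ∀ t, AEMeasurable (X t) μ) {K : ℝ} (hK : 1 ≤ K)
    (hsub : ∀ t, ∀ u : RTensor p, HasSubgaussianMGF (fun ω => inner ℝ u (X t ω))
      (Real.toNNReal (K * ∫ ω, inner ℝ u (X t ω) ^ 2 ∂μ)) μ)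
    (D : CoefTensor q p) {v : ℝ} (hv : 0 < v)
    (hvD : ∀ t, v = ∑ a, ∫ ω, inner ℝ (tensorRow D a) (X t ω) ^ 2 ∂μ) :
    μ.real {ω | (T : ℝ) / 6 * v ≤ |∑ t, ‖contract D (X t ω)‖ ^ 2 - T * v|} ≤
      2 * Real.exp (-(T / (86400 * K ^ 2))) := by
  have hc := continuous_contract D
  have h1 := measureReal_abs_sum_sub_one_le (μ := μ)
    (Z := fun t ω => ‖contract D (X t ω)‖ ^ 2 / v)
    (hind.comp (fun _ x => ‖contract D x‖ ^ 2 / v) fun _ =>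
      (by fun_prop : Continuous fun x => ‖contract D x‖ ^ 2 / v).measurable)
    (fun t => (by fun_prop : Continuous fun x =>
      ‖contract D x‖ ^ 2 / v).measurable.comp_aemeasurable (hX t)) hK fun t l hl => by
        simp_rw [norm_contract_sq]
        exact integral_exp_sum_sq_le hK (fun a => hsub t _) (hvD t) hv hl
  refine le_trans (measureReal_mono ?_) h1
  intro ω hω
  rw [Set.mem_ofPred_eq] at hω ⊢
  have h2 : ∑ t, (‖contract D (X t ω)‖ ^ 2 / v - 1) =
      (∑ t, ‖contract D (X t ω)‖ ^ 2 - T * v) / v := by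
    rw [Finset.sum_sub_distrib, ← Finset.sum_div]
    simp
    field_simp
  rw [h2, abs_div, abs_of_pos hv, le_div_iff₀ hv]
  exact hω

lemma measureReal_abs_sum_inner_contract_le
    (hind : iIndepFun (fun t ω => (X t ω, E t ω)) μ) (hX : ∀ t, AEMeasurable (X t) μ)
    (hE : ∀ t, AEMeasurable (E t) μ) {κ : ℝ} (hκ : 0 < κ)
    (herr : ∀ t, ErrorAssumption (X t) (E t) κ μ) (hT : 0 < T) (D : CoefTensor q p) {v r : ℝ}
    (hv : 0 < v) (hr : 0 ≤ r) :
    μ.real {ω | r * √v ≤ |∑ t, inner ℝ (contract D (X t ω)) (E t ω)| ∧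
        ∑ t, ‖contract D (X t ω)‖ ^ 2 ≤ 3 / 2 * (T * v)} ≤
      2 * Real.exp (-(r ^ 2 / (3 * κ ^ 2 * T))) := by
  have hT' : (0 : ℝ) < T := by exact_mod_cast hT
  have hs : 0 < √v := Real.sqrt_pos.2 hv
  have hsv : √v ^ 2 = v := Real.sq_sqrt hv.le
  -- The value of `l` maximizing `l r √v - (3/4) l² κ² T v`.
  set l : ℝ := 2 * r / (3 * κ ^ 2 * T * √v) with hl
  have hl0 : 0 ≤ l := by positivity
  have hopt : l * (r * √v) - κ ^ 2 * (l ^ 2 * (3 / 2 * (T * v))) / 2 = r ^ 2 / (3 * κ ^ 2 * T) := by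
    have h0 : l * (r * √v) - κ ^ 2 * (l ^ 2 * (3 / 2 * (T * √v ^ 2))) / 2 =
        r ^ 2 / (3 * κ ^ 2 * T) := by
      rw [hl]
      field_simp
      ring
    rwa [hsv] at h0
  have hc := continuous_contract D
  have key : ∀ s : ℝ, s ^ 2 = 1 →
      μ.real {ω | r * √v ≤ s * ∑ t, inner ℝ (contract D (X t ω)) (E t ω) ∧
      ∑ t, ‖contract D (X t ω)‖ ^ 2 ≤ 3 / 2 * (T * v)} ≤
      Real.exp (-(r ^ 2 / (3 * κ ^ 2 * T))) := by
    intro s hs1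
    let φ : RTensor p → RTensor q := fun x => (l * s) • contract D x
    have hφ : Continuous φ := by fun_prop
    let f : RTensor p × RTensor q → ℝ := fun z => inner ℝ (φ z.1) z.2 - κ ^ 2 * ‖φ z.1‖ ^ 2 / 2
    have hf : Continuous f := by fun_prop
    have hexp := fun t => (herr t).integral_exp_inner_le (hX t) (hE t) hφ.measurable
    have h1 := measureReal_le_sum_le_exp (μ := μ) (l := 1) (b := 0)
      (W := fun t ω => f (X t ω, E t ω)) (hind.comp (fun _ => f) fun _ => hf.measurable)
      (fun t => hf.measurable.comp_aemeasurable ((hX t).prodMk (hE t))) zero_le_one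
      (fun t => by simpa [f] using (hexp t).1) (fun t => by simpa [f] using (hexp t).2)
      (r ^ 2 / (3 * κ ^ 2 * T))
    simp only [mul_zero, one_mul, zero_sub] at h1
    refine le_trans (measureReal_mono ?_) h1
    rintro ω ⟨h2, h3⟩
    rw [Set.mem_ofPred_eq, ← hopt]
    have h4 : ∑ t, f (X t ω, E t ω) = l * (s * ∑ t, inner ℝ (contract D (X t ω)) (E t ω)) -
        κ ^ 2 * (l ^ 2 * ∑ t, ‖contract D (X t ω)‖ ^ 2) / 2 := by
      simp only [f, φ, norm_smul, inner_smul_left, conj_trivial, mul_pow, Real.norm_eq_abs,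
        sq_abs, hs1, mul_one, Finset.sum_sub_distrib, Finset.mul_sum, Finset.sum_div]
      simp only [mul_assoc]
    rw [h4]
    gcongr
  have hsub : {ω | r * √v ≤ |∑ t, inner ℝ (contract D (X t ω)) (E t ω)| ∧
        ∑ t, ‖contract D (X t ω)‖ ^ 2 ≤ 3 / 2 * (T * v)} ⊆
      {ω | r * √v ≤ 1 * ∑ t, inner ℝ (contract D (X t ω)) (E t ω) ∧
        ∑ t, ‖contract D (X t ω)‖ ^ 2 ≤ 3 / 2 * (T * v)} ∪
      {ω | r * √v ≤ -1 * ∑ t, inner ℝ (contract D (X t ω)) (E t ω) ∧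
        ∑ t, ‖contract D (X t ω)‖ ^ 2 ≤ 3 / 2 * (T * v)} := by
    rintro ω ⟨h1, h2⟩
    rcases le_abs.1 h1 with h | h
    · exact Or.inl ⟨by simpa using h, h2⟩
    · exact Or.inr ⟨by simpa using h, h2⟩
  have hp := key 1 (by norm_num)
  have hn := key (-1) (by norm_num)
  calc _ ≤ _ := measureReal_mono hsub
    _ ≤ _ := measureReal_union_le _ _
    _ ≤ _ := by linarith

end Tails

/-! ### Norming sets for the model -/

section Uniform

variable {n m : ℕ} {q : Fin n → ℕ} {p : Fin m → ℕ} {Ry Rx : ℕ}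

/-- A norming set for the relative deviation of the empirical quadratic form from `T * v(D)`. -/
lemma exists_norming_finset_quad [Nonempty (ParamIdx q p Ry Rx)] (T : ℕ) (A : CoefTensor q p)
    {M : Matrix (MultiIdx p) (MultiIdx p) ℝ} {cx : ℝ} (hcx : 0 < cx)
    (hM : ∀ D : CoefTensor q p, cx * ‖D‖ ^ 2 ≤ quadVar M D) :
    ∃ J : Finset (ParamIdx q p Ry Rx → ℝ), (∀ θ ∈ J, 0 < quadVar M (paramDiff A θ)) ∧
      (J.card : ℝ) ≤ (27 * (((n + m + 1) * 2 : ℕ) : ℝ) ^ 2) ^ Fintype.card (ParamIdx q p Ry Rx) ∧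
      ∀ x : Fin T → RTensor p,
        (∀ θ ∈ J, |∑ t, ‖contract (paramDiff A θ) (x t)‖ ^ 2 - T * quadVar M (paramDiff A θ)| ≤
          T / 6 * quadVar M (paramDiff A θ)) →
        ∀ θ : ParamIdx q p Ry Rx → ℝ, 0 < quadVar M (paramDiff A θ) →
          |∑ t, ‖contract (paramDiff A θ) (x t)‖ ^ 2 - T * quadVar M (paramDiff A θ)| ≤
            T / 2 * quadVar M (paramDiff A θ) := by
  obtain ⟨J, hJ, hcard, hnorm⟩ := exists_norming_finset (d := (n + m + 1) * 2) (by omega)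
    (fun (x : Fin T → RTensor p) (θ : ParamIdx q p Ry Rx → ℝ) =>
      ∑ t, ‖contract (paramDiff A θ) (x t)‖ ^ 2 - T * quadVar M (paramDiff A θ))
    (fun x => Submodule.sub_mem _
      (polyDeg_sum _ fun t _ => norm_contract_sq_mem_polyDeg A (x t))
      ((polyDeg _ _).smul_mem (T : ℝ) (quadVar_mem_polyDeg A M)))
    (fun θ => quadVar M (paramDiff A θ)) {θ | 0 < quadVar M (paramDiff A θ)} (fun θ hθ => hθ)
    (fun x => by
      refine ⟨(∑ t, ‖x t‖ ^ 2) / cx + T, fun θ hθ => ?_⟩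
      rw [Set.mem_ofPred_eq] at hθ
      have h1 : ∑ t, ‖contract (paramDiff A θ) (x t)‖ ^ 2 ≤
          (∑ t, ‖x t‖ ^ 2) / cx * quadVar M (paramDiff A θ) := by
        rw [div_mul_eq_mul_div, le_div_iff₀ hcx, Finset.sum_mul, Finset.sum_mul]
        refine Finset.sum_le_sum fun t _ => ?_
        nlinarith [norm_contract_sq_le (paramDiff A θ) (x t), hM (paramDiff A θ),
          sq_nonneg ‖x t‖]
      refine (abs_sub _ _).trans ?_
      rw [abs_of_nonneg (by positivity), abs_of_nonneg (by positivity)]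
      linarith)
  refine ⟨J, fun θ hθ => hJ θ hθ, hcard, fun x hx θ hθ => ?_⟩
  have := hnorm x (T / 6) (by positivity) hx θ hθ
  linarith

/-- A norming set for the noise term relative to `√(v(D))`. It is chosen before the sample, hence it
does not depend on the covariates. -/
lemma exists_norming_finset_noise [Nonempty (ParamIdx q p Ry Rx)] (T : ℕ) (A : CoefTensor q p)
    {M : Matrix (MultiIdx p) (MultiIdx p) ℝ} {cx : ℝ} (hcx : 0 < cx)
    (hM : ∀ D : CoefTensor q p, cx * ‖D‖ ^ 2 ≤ quadVar M D) :
    ∃ J : Finset (ParamIdx q p Ry Rx → ℝ), (∀ θ ∈ J, 0 < quadVar M (paramDiff A θ)) ∧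
      (J.card : ℝ) ≤ (27 * ((n + m + 1 : ℕ) : ℝ) ^ 2) ^ Fintype.card (ParamIdx q p Ry Rx) ∧
      ∀ (x : Fin T → RTensor p) (e : Fin T → RTensor q) (r : ℝ), 0 ≤ r →
        (∀ θ ∈ J, |∑ t, inner ℝ (contract (paramDiff A θ) (x t)) (e t)| ≤
          r * √(quadVar M (paramDiff A θ))) →
        ∀ θ : ParamIdx q p Ry Rx → ℝ, 0 < quadVar M (paramDiff A θ) →
          |∑ t, inner ℝ (contract (paramDiff A θ) (x t)) (e t)| ≤
            3 * r * √(quadVar M (paramDiff A θ)) := by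
  obtain ⟨J, hJ, hcard, hnorm⟩ := exists_norming_finset (d := n + m + 1) (by omega)
    (fun (xe : (Fin T → RTensor p) × (Fin T → RTensor q)) (θ : ParamIdx q p Ry Rx → ℝ) =>
      ∑ t, inner ℝ (contract (paramDiff A θ) (xe.1 t)) (xe.2 t))
    (fun xe => polyDeg_sum _ fun t _ => inner_contract_mem_polyDeg A (xe.1 t) (xe.2 t))
    (fun θ => √(quadVar M (paramDiff A θ))) {θ | 0 < quadVar M (paramDiff A θ)}
    (fun θ hθ => Real.sqrt_pos.2 hθ)
    (fun xe => by
      refine ⟨∑ t, ‖xe.1 t‖ * ‖xe.2 t‖ / √cx, fun θ hθ => ?_⟩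
      have hs : 0 < √cx := Real.sqrt_pos.2 hcx
      have h1 : √cx * ‖paramDiff A θ‖ ≤ √(quadVar M (paramDiff A θ)) := by
        refine Real.le_sqrt_of_sq_le ?_
        rw [mul_pow, Real.sq_sqrt hcx.le]
        exact hM _
      rw [Finset.sum_mul]
      refine (Finset.abs_sum_le_sum_abs _ _).trans (Finset.sum_le_sum fun t _ => ?_)
      have h2 : ‖contract (paramDiff A θ) (xe.1 t)‖ ≤ ‖paramDiff A θ‖ * ‖xe.1 t‖ := by
        have := norm_contract_sq_le (paramDiff A θ) (xe.1 t)
        rw [← mul_pow] at this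
        exact le_of_sq_le_sq this (by positivity)
      calc |inner ℝ (contract (paramDiff A θ) (xe.1 t)) (xe.2 t)|
          ≤ ‖contract (paramDiff A θ) (xe.1 t)‖ * ‖xe.2 t‖ := abs_real_inner_le_norm _ _
        _ ≤ ‖paramDiff A θ‖ * ‖xe.1 t‖ * ‖xe.2 t‖ := by gcongr
        _ = ‖xe.1 t‖ * ‖xe.2 t‖ / √cx * (√cx * ‖paramDiff A θ‖) := by field_simp
        _ ≤ _ := by gcongr)
  exact ⟨J, fun θ hθ => hJ θ hθ, hcard, fun x e r hr hxe θ hθ => hnorm (x, e) r hr hxe θ hθ⟩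

end Uniform

/-! ### The error bound -/

section Event

variable {n m T : ℕ} {q : Fin n → ℕ} {p : Fin m → ℕ} {Ry Rx : ℕ} {Ω : Type*}
  [MeasurableSpace Ω] {μ : Measure Ω} {X : Fin T → Ω → RTensor p} {E : Fin T → Ω → RTensor q}

lemma measureReal_biUnion_finset_le_card_mul {α : Type*} (J : Finset α) (B : α → Set Ω) {b : ℝ}
    (hb : ∀ j ∈ J, μ.real (B j) ≤ b) : μ.real (⋃ j ∈ J, B j) ≤ J.card * b :=
  (measureReal_biUnion_finset_le J B).trans (by simpa using Finset.sum_le_sum hb)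

/-- With high probability, every tensor of the class whose residual sum of squares does not exceed
that of `A` is close to `A`. The number `N` bounds the logarithm of the size of the norming sets,
and `r` is the level of the noise. -/
lemma exists_event_norm_paramDiff_le [IsProbabilityMeasure μ] [Nonempty (ParamIdx q p Ry Rx)]
    (hind : iIndepFun (fun t ω => (X t ω, E t ω)) μ) (hX : ∀ t, AEMeasurable (X t) μ)
    (hE : ∀ t, AEMeasurable (E t) μ) {σ κ cx Cx K N r : ℝ} (hκ : 0 < κ) (hK : 1 ≤ K)
    (hr : 0 ≤ r) (hT : 0 < T) (hcx : 0 < cx) (hcov : ∀ t, CovariateAssumption (X t) σ cx Cx μ)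
    (herr : ∀ t, ErrorAssumption (X t) (E t) κ μ)
    {M : Matrix (MultiIdx p) (MultiIdx p) ℝ} (hM : ∀ t, covMat (X t) μ = M)
    (hsub : ∀ t, ∀ u : RTensor p, HasSubgaussianMGF (fun ω => inner ℝ u (X t ω))
      (Real.toNNReal (K * ∫ ω, inner ℝ u (X t ω) ^ 2 ∂μ)) μ) (A : CoefTensor q p)
    (hN : (27 * (((n + m + 1) * 2 : ℕ) : ℝ) ^ 2) ^ Fintype.card (ParamIdx q p Ry Rx) ≤ Real.exp N)
    (hN2 : 2 ≤ Real.exp N) :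
    ∃ S : Set Ω, MeasurableSet S ∧
      1 - Real.exp (2 * N - r ^ 2 / (3 * κ ^ 2 * T)) - Real.exp (2 * N - T / (86400 * K ^ 2)) ≤
        μ.real S ∧
      ∀ ω ∈ S, ∀ θ : ParamIdx q p Ry Rx → ℝ,
        ∑ t, ‖E t ω - contract (paramDiff A θ) (X t ω)‖ ^ 2 ≤ ∑ t, ‖E t ω‖ ^ 2 →
        ‖paramDiff A θ‖ ≤ 12 * r / (T * √cx) := by
  have hT' : (0 : ℝ) < T := by exact_mod_cast hT
  have hquad : ∀ D : CoefTensor q p, cx * ‖D‖ ^ 2 ≤ quadVar M D := fun D => by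
    rw [← hM ⟨0, hT⟩]
    exact (hcov _).mul_norm_sq_le_quadVar D
  obtain ⟨J₁, hJ₁, hcard₁, hnorm₁⟩ :=
    exists_norming_finset_quad (Ry := Ry) (Rx := Rx) T A hcx hquad
  obtain ⟨J₂, hJ₂, hcard₂, hnorm₂⟩ :=
    exists_norming_finset_noise (Ry := Ry) (Rx := Rx) T A hcx hquad
  set B₁ : Set Ω := ⋃ θ ∈ J₁, {ω | (T : ℝ) / 6 * quadVar M (paramDiff A θ) ≤
    |∑ t, ‖contract (paramDiff A θ) (X t ω)‖ ^ 2 - T * quadVar M (paramDiff A θ)|} with hB₁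
  set B₂ : Set Ω := ⋃ θ ∈ J₂, {ω | r * √(quadVar M (paramDiff A θ)) ≤
    |∑ t, inner ℝ (contract (paramDiff A θ) (X t ω)) (E t ω)| ∧
      ∑ t, ‖contract (paramDiff A θ) (X t ω)‖ ^ 2 ≤ 3 / 2 * (T * quadVar M (paramDiff A θ))}
    with hB₂
  have hcard₂' : (J₂.card : ℝ) ≤ Real.exp N := by
    refine (hcard₂.trans ?_).trans hN
    gcongr
    omega
  have hexp : ∀ {c y : ℝ}, 0 ≤ c → c ≤ Real.exp N →
      c * (2 * Real.exp (-y)) ≤ Real.exp (2 * N - y) := by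
    intro c y hc0 hc
    rw [show 2 * N - y = N + (N + -y) by ring, Real.exp_add, Real.exp_add]
    gcongr
  have hP₁ : μ.real B₁ ≤ Real.exp (2 * N - T / (86400 * K ^ 2)) := by
    refine (measureReal_biUnion_finset_le_card_mul J₁ _ fun θ hθ => ?_).trans
      (hexp (Nat.cast_nonneg _) (hcard₁.trans hN))
    refine measureReal_abs_sum_norm_contract_sq_sub_le (X := X)
      (hind.comp (fun _ => Prod.fst) fun _ => measurable_fst) hX hK hsub _ (hJ₁ θ hθ) fun t => ?_
    rw [← (hcov t).quadVar_eq, hM t]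
  have hP₂ : μ.real B₂ ≤ Real.exp (2 * N - r ^ 2 / (3 * κ ^ 2 * T)) :=
    (measureReal_biUnion_finset_le_card_mul J₂ _ fun θ hθ =>
      measureReal_abs_sum_inner_contract_le hind hX hE hκ herr hT _ (hJ₂ θ hθ) hr).trans
      (hexp (Nat.cast_nonneg _) hcard₂')
  refine ⟨(toMeasurable μ (B₁ ∪ B₂))ᶜ, (measurableSet_toMeasurable _ _).compl, ?_, ?_⟩
  · rw [probReal_compl_eq_one_sub (measurableSet_toMeasurable _ _)]
    have h1 : μ.real (toMeasurable μ (B₁ ∪ B₂)) = μ.real (B₁ ∪ B₂) := by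
      simp [measureReal_def, measure_toMeasurable]
    rw [h1]
    linarith [measureReal_union_le (μ := μ) B₁ B₂]
  · intro ω hω θ hθ
    have hω' : ω ∉ B₁ ∪ B₂ := fun h => hω (subset_toMeasurable _ _ h)
    have hω₁ : ω ∉ B₁ := fun h => hω' (Or.inl h)
    have hω₂ : ω ∉ B₂ := fun h => hω' (Or.inr h)
    simp only [hB₁, hB₂, Set.mem_iUnion, not_exists, Set.mem_ofPred_eq, not_le] at hω₁ hω₂
    have hall := hnorm₁ (fun t => X t ω) fun θ' hθ' => (hω₁ θ' hθ').le
    have hnoise := hnorm₂ (fun t => X t ω) (fun t => E t ω) r hr fun θ' hθ' => by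
      have h1 := (abs_le.1 (hall θ' (hJ₂ θ' hθ'))).2
      by_contra! h2
      exact hω₂ θ' hθ' ⟨h2.le, by linarith⟩
    set D := paramDiff A θ
    set v := quadVar M D with hv
    have hvD : cx * ‖D‖ ^ 2 ≤ v := hquad D
    have hs : 0 < √cx := Real.sqrt_pos.2 hcx
    have hv0 : 0 ≤ v := le_trans (by positivity) hvD
    have hDv : √cx * ‖D‖ ≤ √v := by
      refine Real.le_sqrt_of_sq_le ?_
      rwa [mul_pow, Real.sq_sqrt hcx.le]
    have hvle : √v ≤ 12 * r / T := by
      rcases hv0.eq_or_lt with h0 | hpos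
      · rw [← h0, Real.sqrt_zero]
        positivity
      · have h1 := (abs_le.1 (hall θ hpos)).1
        have h2 := (abs_le.1 (hnoise θ hpos)).2
        -- The basic inequality of least squares.
        have h3 : ∑ t, ‖contract D (X t ω)‖ ^ 2 ≤
            2 * ∑ t, inner ℝ (contract D (X t ω)) (E t ω) := by
          simp_rw [norm_sub_sq_real] at hθ
          rw [Finset.sum_add_distrib, Finset.sum_sub_distrib, ← Finset.mul_sum] at hθ
          have h8 : ∀ t, inner ℝ (E t ω) (contract D (X t ω)) =
              inner ℝ (contract D (X t ω)) (E t ω) := fun t => real_inner_comm _ _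
          simp_rw [h8] at hθ
          linarith
        have h4 : (T : ℝ) / 2 * v ≤ 6 * r * √v := by
          linarith
        have h5 : √v * √v = v := Real.mul_self_sqrt hv0
        have h6 : 0 < √v := Real.sqrt_pos.2 hpos
        rw [le_div_iff₀ hT']
        have h7 : (√v * T) * √v ≤ (12 * r) * √v := by nlinarith
        exact le_of_mul_le_mul_right h7 h6
    rw [le_div_iff₀ (by positivity)]
    rw [le_div_iff₀ hT'] at hvle
    calc ‖D‖ * (T * √cx) = √cx * ‖D‖ * T := by ring
      _ ≤ √v * T := by gcongr
      _ ≤ _ := hvle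

end Event

/-! ### Arithmetic of the complexity measures -/

lemma dc_eq_half_log (n m Ry Rx : ℕ) :
    dc n m Ry Rx = Real.log ((max m n ^ 2 * min Ry Rx ^ 2 * Ry * Rx : ℕ) : ℝ) / 2 := by
  have h : ((max m n ^ 2 * min Ry Rx ^ 2 * Ry * Rx : ℕ) : ℝ) =
      (max (m : ℝ) n * min (Ry : ℝ) Rx * √(Ry : ℝ) * √(Rx : ℝ)) ^ 2 := by
    rw [mul_pow, mul_pow, mul_pow, Real.sq_sqrt (Nat.cast_nonneg _),
      Real.sq_sqrt (Nat.cast_nonneg _)]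
    push_cast
    rfl
  rw [dc, h, Real.log_pow]
  push_cast
  ring

/-- As `exp (2 * dc)` is a natural number, `dc` cannot be positive but small. -/
lemma dc_eq_zero_or_log_two_le {n m Ry Rx : ℕ} (hn : 1 ≤ n) (hRy : 1 ≤ Ry) (hRx : 1 ≤ Rx) :
    dc n m Ry Rx = 0 ∨ Real.log 2 ≤ 2 * dc n m Ry Rx := by
  rw [dc_eq_half_log]
  set W := max m n ^ 2 * min Ry Rx ^ 2 * Ry * Rx with hW
  have h1 : 0 < max m n := lt_max_of_lt_right hn
  have h2 : 0 < min Ry Rx := lt_min hRy hRx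
  have hW1 : 1 ≤ W := Nat.one_le_iff_ne_zero.2 (by positivity)
  rcases hW1.eq_or_lt with h | h
  · left; rw [← h]; simp
  · right
    have h3 : Real.log 2 ≤ Real.log (W : ℝ) :=
      Real.log_le_log (by norm_num) (by exact_mod_cast h)
    linarith

lemma one_le_min_mul_sqrt {Ry Rx : ℕ} (hRy : 1 ≤ Ry) (hRx : 1 ≤ Rx) :
    1 ≤ min (Ry : ℝ) Rx * √(Ry : ℝ) * √(Rx : ℝ) := by
  have h1 : (1 : ℝ) ≤ Ry := by exact_mod_cast hRy
  have h2 : (1 : ℝ) ≤ Rx := by exact_mod_cast hRx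
  exact one_le_mul_of_one_le_of_one_le
    (one_le_mul_of_one_le_of_one_le (le_min h1 h2) (Real.one_le_sqrt.2 h1)) (Real.one_le_sqrt.2 h2)

lemma log_max_le_dc {n m Ry Rx : ℕ} (hn : 1 ≤ n) (hRy : 1 ≤ Ry) (hRx : 1 ≤ Rx) :
    Real.log (max (m : ℝ) n) ≤ dc n m Ry Rx := by
  have hn' : (1 : ℝ) ≤ n := by exact_mod_cast hn
  have hmax : 0 < max (m : ℝ) n := lt_max_of_lt_right (by linarith)
  refine Real.log_le_log hmax ?_
  have := one_le_min_mul_sqrt hRy hRx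
  rw [mul_assoc, mul_assoc, ← mul_assoc (min _ _)]
  exact le_mul_of_one_le_right hmax.le this

lemma dc'_le_dc {n m Ry Rx : ℕ} (hm : 1 ≤ m) (hRy : 1 ≤ Ry) (hRx : 1 ≤ Rx) :
    dc' m Ry Rx ≤ dc n m Ry Rx := by
  have hm' : (0 : ℝ) < m := by exact_mod_cast hm
  have hRy' : (0 : ℝ) < Ry := by exact_mod_cast hRy
  have hRx' : (0 : ℝ) < Rx := by exact_mod_cast hRx
  have : 0 < min (Ry : ℝ) Rx := lt_min hRy' hRx'
  refine Real.log_le_log (by positivity) ?_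
  gcongr
  exact le_max_left _ _

lemma dLR'_le_dLR {n m : ℕ} {q : Fin n → ℕ} (p : Fin m → ℕ) (Ry Rx : ℕ) (hn : 1 ≤ n)
    (hq : ∀ i, 1 ≤ q i) : dLR' p Ry Rx ≤ dLR q p Ry Rx := by
  have h1 : (1 : ℝ) ≤ ∑ i, (q i : ℝ) := by
    have h2 : (1 : ℝ) ≤ q ⟨0, hn⟩ := by exact_mod_cast hq _
    exact h2.trans (Finset.single_le_sum (f := fun i => (q i : ℝ))
      (fun i _ => Nat.cast_nonneg _) (Finset.mem_univ _))
  have h3 : (Ry : ℝ) ≤ Ry * ∑ i, (q i : ℝ) := le_mul_of_one_le_right (Nat.cast_nonneg _) h1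
  unfold dLR dLR'
  linarith

lemma one_le_dLR {n m : ℕ} (q : Fin n → ℕ) (p : Fin m → ℕ) {Ry Rx : ℕ} (hRy : 1 ≤ Ry)
    (hRx : 1 ≤ Rx) : 1 ≤ dLR q p Ry Rx := by
  have h1 : (1 : ℝ) ≤ Ry * Rx := by exact_mod_cast Nat.mul_pos hRy hRx
  have h2 : 0 ≤ (Ry : ℝ) * ∑ i, (q i : ℝ) := by positivity
  have h3 : 0 ≤ (Rx : ℝ) * ∑ j, (p j : ℝ) := by positivity
  unfold dLR
  linarith

/-- The logarithm of the size of the norming sets is of order `dc * dLR`. -/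
lemma pow_card_paramIdx_le_exp {n m : ℕ} (q : Fin n → ℕ) (p : Fin m → ℕ) {Ry Rx : ℕ} (hn : 1 ≤ n)
    (hRy : 1 ≤ Ry) (hRx : 1 ≤ Rx) (hdc : Real.log 2 ≤ 2 * dc n m Ry Rx) :
    (27 * (((n + m + 1) * 2 : ℕ) : ℝ) ^ 2) ^ Fintype.card (ParamIdx q p Ry Rx) ≤
      Real.exp (22 * (dc n m Ry Rx * dLR q p Ry Rx)) := by
  have hn' : (1 : ℝ) ≤ n := by exact_mod_cast hn
  set M := max (m : ℝ) n with hM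
  have hMn : (n : ℝ) ≤ M := le_max_right _ _
  have hMm : (m : ℝ) ≤ M := le_max_left _ _
  have hM0 : 0 < M := by linarith
  have h1 : M ≤ Real.exp (dc n m Ry Rx) := by
    rw [← Real.log_le_iff_le_exp hM0]
    exact log_max_le_dc hn hRy hRx
  have h2 : (2 : ℝ) ≤ Real.exp (2 * dc n m Ry Rx) := by
    rwa [← Real.log_le_iff_le_exp two_pos]
  have h3 : 27 * (((n + m + 1) * 2 : ℕ) : ℝ) ^ 2 ≤ 2 ^ 10 * M ^ 2 := by
    push_cast
    have h4 : ((n : ℝ) + m + 1) * 2 ≤ 6 * M := by linarith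
    have h5 : (((n : ℝ) + m + 1) * 2) ^ 2 ≤ (6 * M) ^ 2 := by gcongr
    nlinarith [sq_nonneg M]
  have h6 : 27 * (((n + m + 1) * 2 : ℕ) : ℝ) ^ 2 ≤ Real.exp (22 * dc n m Ry Rx) := by
    calc _ ≤ 2 ^ 10 * M ^ 2 := h3
      _ ≤ Real.exp (2 * dc n m Ry Rx) ^ 10 * Real.exp (dc n m Ry Rx) ^ 2 := by gcongr
      _ = _ := by
        rw [← Real.exp_nat_mul, ← Real.exp_nat_mul, ← Real.exp_add]
        congr 1
        push_cast
        ring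
  calc _ ≤ Real.exp (22 * dc n m Ry Rx) ^ Fintype.card (ParamIdx q p Ry Rx) := by gcongr
    _ = _ := by
      rw [← Real.exp_nat_mul, card_paramIdx]
      congr 1
      ring

/-! ### Reduction to the uniform bound -/

lemma one_le_of_mem_loadingSet {k R : ℕ} {d : Fin k → ℕ} {L : Matrix (MultiIdx d) (Fin R) ℝ}
    (hL : L ∈ loadingSet d R) (hR : 1 ≤ R) (i : Fin k) : 1 ≤ d i := by
  obtain ⟨U, hU, -⟩ := hL
  by_contra! h
  have : IsEmpty (Fin (d i)) := by
    rw [Nat.lt_one_iff.1 h]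
    infer_instance
  simpa [EuclideanSpace.norm_eq] using hU i ⟨0, hR⟩

lemma thetaLRBdd_subset_thetaLR {n m : ℕ} (q : Fin n → ℕ) (p : Fin m → ℕ) (Ry Rx : ℕ) (g : ℝ) :
    thetaLRBdd q p Ry Rx g ⊆ thetaLR q p Ry Rx := by
  rintro A ⟨Ly, hLy, G, Lx, hLx, -, hA⟩
  exact ⟨Ly, hLy, G, Lx, hLx, hA⟩

lemma sum_norm_sub_contract_sq_le_of_isOLS {n m T : ℕ} {q : Fin n → ℕ} {p : Fin m → ℕ}
    {C : Set (CoefTensor q p)} {x : Fin T → RTensor p} {y e : Fin T → RTensor q}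
    {A B : CoefTensor q p} (hT : 0 < T) (hy : ∀ t, y t = contract A (x t) + e t)
    (hB : IsOLS C x y B) (hA : A ∈ C) :
    ∑ t, ‖e t - contract (B - A) (x t)‖ ^ 2 ≤ ∑ t, ‖e t‖ ^ 2 := by
  have hT' : (0 : ℝ) < T := by exact_mod_cast hT
  have h1 := hB.2 A hA
  unfold olsLoss at h1
  rw [div_le_div_iff_of_pos_right hT'] at h1
  have h2 : ∀ t, y t - contract B (x t) = e t - contract (B - A) (x t) := fun t => by
    rw [hy, contract_sub]; abel
  have h3 : ∀ t, y t - contract A (x t) = e t := fun t => by rw [hy]; abel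
  simpa only [h2, h3] using h1

/-- The covariates enter only through the ratio `K` of the sub-Gaussian parameter of each of their
projections to its variance; both sample size conditions reduce to this form. -/
lemma exists_sub_gaussian_ratio {n m T : ℕ} {q : Fin n → ℕ} {p : Fin m → ℕ} {Ry Rx : ℕ}
    {σ cx Cx C₀ : ℝ} {Ω : Type*} [MeasurableSpace Ω] {μ : Measure Ω}
    {X : Fin T → Ω → RTensor p} (hcx : 0 < cx)
    (hcov : ∀ t, CovariateAssumption (X t) σ cx Cx μ)
    (hsize : C₀ * max 1 (σ ^ 4 / cx ^ 2) *
        (dc n m Ry Rx * dLR q p Ry Rx + ∑ i, Real.log (q i)) ≤ T ∨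
      (∀ t, IsStandardizedSubGaussianVec (X t) σ μ) ∧
      C₀ * max 1 (σ ^ 4) * (dc n m Ry Rx * dLR q p Ry Rx + ∑ i, Real.log (q i)) ≤ T) :
    ∃ K : ℝ, 1 ≤ K ∧
      (∀ t, ∀ u : RTensor p, HasSubgaussianMGF (fun ω => inner ℝ u (X t ω))
        (Real.toNNReal (K * ∫ ω, inner ℝ u (X t ω) ^ 2 ∂μ)) μ) ∧
      C₀ * K ^ 2 * (dc n m Ry Rx * dLR q p Ry Rx + ∑ i, Real.log (q i)) ≤ T := by
  have hsq : ∀ a : ℝ, 0 ≤ a → max 1 a ^ 2 = max 1 (a ^ 2) := by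
    intro a ha
    rcases le_total 1 a with h | h
    · rw [max_eq_right h, max_eq_right (by nlinarith)]
    · rw [max_eq_left h, max_eq_left (by nlinarith), one_pow]
  rcases hsize with hT | ⟨hstd, hT⟩
  · refine ⟨max 1 (σ ^ 2 / cx), le_max_left _ _, fun t u => ?_, ?_⟩
    · refine ((hcov t).subGaussian u).mono (Real.toNNReal_le_toNNReal ?_)
      have h1 := (hcov t).mul_norm_sq_le u
      rw [← (hcov t).integral_inner_sq] at h1
      calc σ ^ 2 * ‖u‖ ^ 2 = σ ^ 2 / cx * (cx * ‖u‖ ^ 2) := by field_simp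
        _ ≤ max 1 (σ ^ 2 / cx) * (cx * ‖u‖ ^ 2) := by
          gcongr
          exact le_max_right _ _
        _ ≤ _ := by gcongr
    · rw [hsq _ (by positivity), div_pow, ← pow_mul]
      exact hT
  · refine ⟨max 1 (σ ^ 2), le_max_left _ _, fun t u => ?_, ?_⟩
    · refine (hstd t u).mono (Real.toNNReal_le_toNNReal ?_)
      rw [← (hcov t).integral_inner_sq]
      refine mul_le_mul_of_nonneg_right (le_max_right _ _) ?_
      exact integral_nonneg fun _ => sq_nonneg _
    · rw [hsq _ (by positivity), ← pow_mul]
      exact hT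

theorem theorem1 (g : ℝ) (hg : 0 < g) :
    ∃ C₀ C₁ c₁ c₂ c₃ : ℝ, 0 < C₀ ∧ 0 < C₁ ∧ 0 < c₁ ∧ 0 < c₂ ∧ 0 < c₃ ∧
      ∀ (n m : ℕ) (q : Fin n → ℕ) (p : Fin m → ℕ) (Ry Rx T : ℕ) (σ κ cx Cx : ℝ),
        1 ≤ n → 1 ≤ m → 1 ≤ Ry → 1 ≤ Rx → 0 < σ → 0 < κ →
      ∀ (Ω : Type*) [MeasurableSpace Ω] (μ : Measure Ω) [IsProbabilityMeasure μ]
        (X : Fin T → Ω → RTensor p) (Y E : Fin T → Ω → RTensor q) (Astar : CoefTensor q p),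
        -- the true coefficient tensor lies in the class, with operator norm of `G` at most `g`
        Astar ∈ thetaLRBdd q p Ry Rx g →
        -- the regression model
        (∀ t ω, Y t ω = contract Astar (X t ω) + E t ω) →
        -- the observations are i.i.d.
        iIndepFun (fun t ω => (X t ω, Y t ω)) μ →
        (∀ s t, IdentDistrib (fun ω => (X s ω, Y s ω)) (fun ω => (X t ω, Y t ω)) μ μ) →
        (∀ t, CovariateAssumption (X t) σ cx Cx μ) →
        (∀ t, ErrorAssumption (X t) (E t) κ μ) →
        -- the sample size
        (C₀ * max 1 (σ ^ 4 / cx ^ 2) * (dc n m Ry Rx * dLR q p Ry Rx + ∑ i, Real.log (q i)) ≤ T ∨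
          (∀ t, IsStandardizedSubGaussianVec (X t) σ μ) ∧
          C₀ * max 1 (σ ^ 4) * (dc n m Ry Rx * dLR q p Ry Rx + ∑ i, Real.log (q i)) ≤ T) →
        ∃ S : Set Ω, MeasurableSet S ∧
          1 - Real.exp (-(c₁ * (dc n m Ry Rx * dLR q p Ry Rx)))
              - Real.exp (-(c₂ * (dc' m Ry Rx * dLR' p Ry Rx)) - c₃ * ∑ i, Real.log (q i))
            ≤ μ.real S ∧
          ∀ ω ∈ S, ∀ Ahat : CoefTensor q p,
            (IsOLS (thetaLR q p Ry Rx) (fun t => X t ω) (fun t => Y t ω) Ahat ∨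
              IsOLS (thetaLRBdd q p Ry Rx g) (fun t => X t ω) (fun t => Y t ω) Ahat) →
            ‖Ahat - Astar‖ ≤ C₁ * (κ * σ / cx) * √(dc n m Ry Rx * dLR q p Ry Rx / T) := by
  refine ⟨3888000, 216, 1, 1, 1, by norm_num, by norm_num, one_pos, one_pos, one_pos, ?_⟩
  intro n m q p Ry Rx T σ κ cx Cx hn hm hRy hRx hσ hκ Ω _ μ _ X Y E A hA hmodel hind hident hcov
    herr hsize
  -- If `dc = 0`, the claimed probability bound is trivial.
  rcases dc_eq_zero_or_log_two_le (m := m) hn hRy hRx with hdc0 | hdc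
  · refine ⟨∅, MeasurableSet.empty, ?_, by simp⟩
    rw [hdc0]
    simp
    positivity
  have hq : ∀ i, 1 ≤ q i := fun i => by
    obtain ⟨_, hL, -⟩ := hA
    exact one_le_of_mem_loadingSet hL hRy i
  have hp : ∀ j, 1 ≤ p j := fun j => by
    obtain ⟨_, -, _, _, hL, -⟩ := hA
    exact one_le_of_mem_loadingSet hL hRx j
  set L := dc n m Ry Rx * dLR q p Ry Rx with hL
  have hdcpos : 0 < dc n m Ry Rx := by linarith [Real.log_pos one_lt_two]
  have hdLR := one_le_dLR q p hRy hRx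
  have hdcL : dc n m Ry Rx ≤ L := le_mul_of_one_le_right hdcpos.le hdLR
  have hL0 : 0 < L := hdcpos.trans_le hdcL
  have hlog : 0 ≤ ∑ i, Real.log (q i) :=
    Finset.sum_nonneg fun i _ => Real.log_nonneg (by exact_mod_cast hq i)
  have hT : 0 < T := by
    have h1 : (0 : ℝ) < T := by
      rcases hsize with h | ⟨-, h⟩ <;> refine lt_of_lt_of_le ?_ h <;> positivity
    exact_mod_cast h1
  have hT' : (0 : ℝ) < T := by exact_mod_cast hT
  have hcx : 0 < cx := (hcov ⟨0, hT⟩).cx_pos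
  obtain ⟨K, hK, hsub, hTK⟩ := exists_sub_gaussian_ratio hcx hcov hsize
  have hK0 : 0 < K := by linarith
  have hXY : ∀ t, AEMeasurable (fun ω => (X t ω, Y t ω)) μ := fun t =>
    (hident t t).aemeasurable_fst
  have hX : ∀ t, AEMeasurable (X t) μ := fun t => measurable_fst.comp_aemeasurable (hXY t)
  have hEY : ∀ t ω, E t ω = Y t ω - contract A (X t ω) := fun t ω => by rw [hmodel]; abel
  have hcA := continuous_contract A
  have hE : ∀ t, AEMeasurable (E t) μ := fun t => by
    have : E t = (fun z : RTensor p × RTensor q => z.2 - contract A z.1) ∘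
        fun ω => (X t ω, Y t ω) := funext fun ω => hEY t ω
    rw [this]
    exact (by fun_prop : Continuous fun z : RTensor p × RTensor q =>
      z.2 - contract A z.1).measurable.comp_aemeasurable (hXY t)
  have hindE : iIndepFun (fun t ω => (X t ω, E t ω)) μ := by
    simp_rw [hEY]
    exact hind.comp (fun _ z => (z.1, z.2 - contract A z.1)) fun _ =>
      (by fun_prop : Continuous fun z : RTensor p × RTensor q =>
        (z.1, z.2 - contract A z.1)).measurable
  have hM : ∀ t, covMat (X t) μ = covMat (X ⟨0, hT⟩) μ := by
    intro t
    ext i j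
    rw [(hcov t).covMat_apply, (hcov _).covMat_apply]
    exact ((hident t ⟨0, hT⟩).comp (u := fun z : RTensor p × RTensor q => z.1 i * z.1 j)
      (by fun_prop)).integral_eq
  have : Nonempty (ParamIdx q p Ry Rx) := ⟨.inl (⟨0, hRy⟩, ⟨0, hRx⟩)⟩
  -- The noise level for which the Gaussian tail exceeds the size of the norming set.
  set r := κ * √(135 * L * T) with hr
  have hr2 : r ^ 2 / (3 * κ ^ 2 * T) = 45 * L := by
    rw [hr, mul_pow, Real.sq_sqrt (by positivity)]
    field_simp
    norm_num
  have hN2 : 2 ≤ Real.exp (22 * L) := by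
    rw [← Real.log_le_iff_le_exp two_pos]
    linarith
  obtain ⟨S, hS, hPS, hgood⟩ := exists_event_norm_paramDiff_le (Ry := Ry) (Rx := Rx) (r := r)
    hindE hX hE hκ hK (by positivity) hT hcx hcov herr hM hsub A
    (pow_card_paramIdx_le_exp q p hn hRy hRx hdc) hN2
  refine ⟨S, hS, le_trans ?_ hPS, fun ω hω B hB => ?_⟩
  · have h1 : 45 * (L + ∑ i, Real.log (q i)) ≤ T / (86400 * K ^ 2) := by
      rw [le_div_iff₀ (by positivity)]
      linarith
    have h2 : dc' m Ry Rx * dLR' p Ry Rx ≤ L := by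
      refine mul_le_mul (dc'_le_dc hm hRy hRx) (dLR'_le_dLR p Ry Rx hn hq) ?_ hdcpos.le
      unfold dLR'
      positivity
    have h3 : Real.exp (2 * (22 * L) - r ^ 2 / (3 * κ ^ 2 * T)) ≤ Real.exp (-(1 * L)) := by
      rw [hr2]
      exact Real.exp_le_exp.2 (by linarith)
    have h4 : Real.exp (2 * (22 * L) - T / (86400 * K ^ 2)) ≤
        Real.exp (-(1 * (dc' m Ry Rx * dLR' p Ry Rx)) - 1 * ∑ i, Real.log (q i)) :=
      Real.exp_le_exp.2 (by linarith)
    linarith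
  · have hAmem := thetaLRBdd_subset_thetaLR q p Ry Rx g hA
    have hbasic : B ∈ thetaLR q p Ry Rx ∧
        ∑ t, ‖E t ω - contract (B - A) (X t ω)‖ ^ 2 ≤ ∑ t, ‖E t ω‖ ^ 2 := by
      rcases hB with hB | hB
      · exact ⟨hB.1, sum_norm_sub_contract_sq_le_of_isOLS hT (fun t => hmodel t ω) hB hAmem⟩
      · exact ⟨thetaLRBdd_subset_thetaLR q p Ry Rx g hB.1,
          sum_norm_sub_contract_sq_le_of_isOLS hT (fun t => hmodel t ω) hB hA⟩
    obtain ⟨θ, hθ⟩ := exists_paramDiff_eq hbasic.1 A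
    have h1 := hgood ω hω θ (by rw [hθ]; exact hbasic.2)
    rw [hθ] at h1
    refine h1.trans ?_
    have : Nonempty (MultiIdx p) := ⟨fun j => ⟨0, hp j⟩⟩
    -- A sub-Gaussian variable has variance at most a multiple of its parameter.
    have hcxσ := (hcov ⟨0, hT⟩).cx_le_two_mul hσ
    have h2 : √cx ≤ 3 / 2 * σ := by
      rw [Real.sqrt_le_left (by positivity)]
      nlinarith
    have h3 : r ≤ κ * (12 * (T * √(L / T))) := by
      rw [hr]
      refine mul_le_mul_of_nonneg_left ?_ hκ.le
      rw [Real.sqrt_le_left (by positivity), mul_pow, mul_pow, Real.sq_sqrt (by positivity)]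
      have : (T : ℝ) ^ 2 * (L / T) = L * T := by field_simp
      rw [this]
      nlinarith [mul_pos hL0 hT']
    have hs : 0 < √cx := Real.sqrt_pos.2 hcx
    have h4 : √cx * √cx = cx := Real.mul_self_sqrt hcx.le
    calc 12 * r / (T * √cx) ≤ 12 * (κ * (12 * (T * √(L / T)))) / (T * √cx) := by gcongr
      _ = 144 * (κ * √cx / (√cx * √cx)) * √(L / T) := by field_simp; norm_num
      _ ≤ 144 * (κ * (3 / 2 * σ) / (√cx * √cx)) * √(L / T) := by gcongr
      _ = 216 * (κ * σ / cx) * √(L / T) := by rw [h4]; ring
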